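/- Let $d\ge 1$, let $D\subset\mathbb R^d$ be a bounded domain (open, connected), and let $L^2(D)$ be the complex Hilbert space with inner product $(f,h)_2=\int_D f\,\bar h\,d\mathsf x$. Let $V:D\to\mathbb R$ be (essentially) bounded from below with $V\in L^q(D)$, where $q\in[1,\infty]$ if $d=1$, $q\in(1,\infty]$ if $d=2$, $q\in[d/2,\infty]$ if $d\ge 3$, and let $\mathcal H=-\frac12\Delta+V$ be the self-adjoint operator in $L^2(D)$ with Neumann boundary conditions, defined by the form $\frac12\int_D|\nabla u|^2+\int_D V|u|^2$ on $\{u\in H^1(D): V|u|^2\in L^1(D)\}$. Fix $T>0$ and let $g$ be the heat kernel of $\mathcal H$ on $(0,T]$, that is, a real measurable function with $e^{-t\mathcal H}f=\int_D g(\cdot,t,\mathsf y)f(\mathsf y)\,d\mathsf y$ for $f\in L^2(D)$ and $t\in(0,T]$. Let $(p_m)_{m\in\mathbb N^d}$ satisfy $p_m\ge 0$, $\sum_m p_m=1$, and let $\varphi_m,\psi_m$ $(m\in\mathbb N^d)$ be real continuous functions on $\overline D$ such that $$\sum_m p_m\,\sup_{\overline D}|\varphi_m|\,\sup_{\overline D}|\psi_m|<\infty$$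 (which holds in particular if $\sup_m\sup_{\overline D}|\varphi_m|<\infty$ and $\sup_m\sup_{\overline D}|\psi_m|<\infty$) and $$(\varphi_m,e^{-T\mathcal H}\psi_n)_2=\delta_{m,n}\qquad(m,n\in\mathbb N^d).$$ Put $u_m(t)=e^{-t\mathcal H}\varphi_m$ and $v_m(t)=e^{-(T-t)\mathcal H}\psi_m$. Then for every $t\in[0,T]$: (a) The series $\mathcal R(t)f=\sum_m p_m(f,u_m(t))_2\,v_m(t)$ converges in $L^2(D)$ for each $f\in L^2(D)$ and defines a trace-class operator $\mathcal R(t)$ on $L^2(D)$, with $\operatorname{Tr}\mathcal R(t)=1$ and $\operatorname{Tr}\mathcal R(t)^2=\sum_m p_m^2\le 1$. (b) $\mathcal R(t)v_m(t)=p_m v_m(t)$ for every $m$. (c) For every bounded self-adjoint operator $B$ on $L^2(D)$, $\mathcal R(t)B$ is trace class and $$\operatorname{Tr}(\mathcal R(t)B)=\sum_m p_m\,(v_m(t),Bu_m(t))_2 ;$$ if moreover $B$ maps real-valued functions to real-valued functions, then also $\operatorname{Tr}(\mathcal R(t)B)=\sum_m p_m\,(Bu_m(t),v_m(t))_2$.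 In particular, let $B$ be multiplication by a real function $b\in L^\infty(D)$, and let $\bar Z_{\tau\in[0,T]}$ be a $\overline D$-valued Bernstein process with two-sided transition function $$\mathbb P(\bar Z_r\in F\mid \bar Z_s,\bar Z_{t'})=Q(\bar Z_{t'},t';F,r;\bar Z_s,s),\qquad Q(\mathsf x,t';F,r;\mathsf y,s)=\int_{F\cap D}\frac{g(\mathsf x,t'-r,\mathsf z)\,g(\mathsf z,r-s,\mathsf y)}{g(\mathsf x,t'-s,\mathsf y)}\,d\mathsf z,$$ for $0\le s<r<t'\le T$ and Borel sets $F$, and such that $(\bar Z_0,\bar Z_T)$ has the distribution $\bar\mu=\sum_m p_m\mu_m$ with $\mu_m(G)=\int_{G\cap(D\times D)}\varphi_m(\mathsf x)\,g(\mathsf x,T,\mathsf y)\,\psi_m(\mathsf y)\,d\mathsf x\,d\mathsf y$ (the individual $\mu_m$ may be signed, the mixture $\bar\mu$ is the law of a pair of random variables). Then $b(\bar Z_t)$ is integrable and $$\operatorname{Tr}(\mathcal R(t)B)=\mathbb E\big(b(\bar Z_t)\big)=\sum_m p_m\int_D b(\mathsf x)\,u_m(\mathsf x,t)\,v_m(\mathsf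 x,t)\,d\mathsf x .$$ -/

import Mathlib

open MeasureTheory Filter Set Topology
open scoped ENNReal

noncomputable section

namespace Bernstein

/-! ### Trace-class operators on a Hilbert space -/

universe u

variable {H : Type u} [NormedAddCommGroup H] [InnerProductSpace ℂ H] [CompleteSpace H]

/-- `A` is trace class: `∑ₙ (|A| hₙ, hₙ) < ∞` for the orthonormal bases `(hₙ)`, where
`|A| = (A* A)^{1/2}`. The terms are non-negative. -/
def IsTraceClass (A : H →L[ℂ] H) : Prop :=
  ∀ (ι : Type u) (h : HilbertBasis ι ℂ H),
    Summable fun n => RCLike.re (inner ℂ (h n) (CFC.abs A (h n)))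

/-- `A` is trace class and its trace is `τ`, that is `∑ₙ (A hₙ, hₙ) = τ` for every orthonormal
basis `(hₙ)`. (Mathlib's inner product is linear in its second argument.) -/
def HasTrace (A : H →L[ℂ] H) (τ : ℂ) : Prop :=
  IsTraceClass A ∧
    ∀ (ι : Type u) (h : HilbertBasis ι ℂ H), HasSum (fun n => inner ℂ (h n) (A (h n))) τ

/-! ### The Neumann Schrödinger operator `-½ Δ + V` -/

/-- Euclidean space `ℝᵈ`. -/
abbrev E (d : ℕ) : Type := EuclideanSpace ℝ (Fin d)

/-- The complex Hilbert space `L²(D)`. -/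
abbrev L2 {d : ℕ} (D : Set (E d)) : Type := Lp ℂ 2 (volume.restrict D)

/-- `u` lies in the Sobolev space `H¹(D)` and `G` is its gradient: `(u, G)` is the limit in `L²`
of pairs `(w, ∇w)` with `w` continuously differentiable on `D`. By the Meyers-Serrin theorem this
is the same as `G` being the weak gradient of `u`, for every open set `D`. -/
def HasSobolevGradient {d : ℕ} (D : Set (E d)) (u : L2 D) (G : Fin d → L2 D) : Prop :=
  ∃ w : ℕ → E d → ℂ,
    (∀ n, ContDiffOn ℝ 1 (w n) D) ∧
    Tendsto (fun n => eLpNorm (fun x => w n x - u x) 2 (volume.restrict D)) atTop (𝓝 0) ∧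
    ∀ i, Tendsto (fun n => eLpNorm
      (fun x => fderiv ℝ (w n) x (EuclideanSpace.single i 1) - G i x) 2 (volume.restrict D))
      atTop (𝓝 0)

/-- `u`, with gradient `G`, lies in the domain of the quadratic form of `-½ Δ + V` with Neumann
boundary conditions: `u ∈ H¹(D)` and `V |u|²` is integrable. -/
def InFormDomain {d : ℕ} (D : Set (E d)) (V : E d → ℝ) (u : L2 D) (G : Fin d → L2 D) : Prop :=
  HasSobolevGradient D u G ∧ Integrable (fun x => V x * ‖u x‖ ^ 2) (volume.restrict D)

/-- The graph of the self-adjoint operator `-½ Δ + V` with Neumann boundary conditions, the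
operator of the quadratic form `½ ∫ |∇u|² + ∫ V |u|²`: `u` is in its domain and is mapped to `h`
when `(h, v) = ½ (∇u, ∇v) + ∫ V u v̄` for all `v` in the form domain. -/
def SchrodingerGraph {d : ℕ} (D : Set (E d)) (V : E d → ℝ) (u h : L2 D) : Prop :=
  ∃ G : Fin d → L2 D, InFormDomain D V u G ∧
    ∀ (v : L2 D) (K : Fin d → L2 D), InFormDomain D V v K →
      inner ℂ v h = (1 / 2 : ℂ) * ∑ i, inner ℂ (K i) (G i) +
        ∫ x in D, (V x : ℂ) * u x * (starRingEnd ℂ) (v x)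

/-- `g` is the heat kernel on `(0, T]` of `∂ₜ w = ½ Δ w - V w` with Neumann boundary conditions:
for every `f ∈ L²(D)` the function equal to `f` at `t = 0` and to `∫_D g(·, t, y) f(y) dy` for
`t ∈ (0, T]` is continuous into `L²(D)` and solves the evolution equation for `t > 0`; it is
therefore `exp(-t(-½ Δ + V)) f`. -/
structure IsHeatKernel {d : ℕ} (D : Set (E d)) (V : E d → ℝ) (T : ℝ)
    (g : E d → ℝ → E d → ℝ) : Prop where
  measurable : ∀ t ∈ Ioc 0 T, Measurable fun z : E d × E d => g z.1 t z.2
  solves : ∀ f : L2 D, ∃ w : ℝ → L2 D, w 0 = f ∧ ContinuousOn w (Icc 0 T) ∧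
    ∀ t ∈ Ioc 0 T,
      (∃ h : L2 D, SchrodingerGraph D V (w t) h ∧ HasDerivWithinAt w (-h) (Icc 0 T) t) ∧
      ∀ᵐ x ∂(volume.restrict D),
        Integrable (fun y => (g x t y : ℂ) * f y) (volume.restrict D) ∧
        w t x = ∫ y in D, (g x t y : ℂ) * f y

/-- The function `exp(-t(-½ Δ + V)) f` for real `f`, through the heat kernel. -/
def heatAct {d : ℕ} (D : Set (E d)) (g : E d → ℝ → E d → ℝ) (t : ℝ) (f : E d → ℝ) (x : E d) : ℝ :=
  if t = 0 then f x else ∫ y in D, g x t y * f y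

/-! ### Bernstein processes -/

variable {Ω : Type*}

/-- The σ-algebra generated by `Z_τ` for `τ` in the set `S` of times. -/
abbrev sigmaOf {d : ℕ} (Z : ℝ → Ω → E d) (S : Set ℝ) : MeasurableSpace Ω :=
  ⨆ τ ∈ S, MeasurableSpace.comap (Z τ) inferInstance

/-- `Z` on the time interval `[0, T]` is a Bernstein process with values in the closure of `D`. -/
structure IsBernsteinProcess [MeasurableSpace Ω] {d : ℕ} (D : Set (E d)) (T : ℝ) (P : Measure Ω)
    (Z : ℝ → Ω → E d) : Prop where
  measurable : ∀ τ ∈ Icc 0 T, Measurable (Z τ)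
  mem_closure : ∀ τ ∈ Icc 0 T, ∀ ω, Z τ ω ∈ closure D
  bernstein : ∀ s r t : ℝ, 0 ≤ s → s < r → r < t → t ≤ T →
    ∀ b : E d → ℂ, Measurable b → (∃ C : ℝ, ∀ x, ‖b x‖ ≤ C) →
      P[fun ω => b (Z r ω) | sigmaOf Z (Icc 0 s) ⊔ sigmaOf Z (Icc t T)] =ᵐ[P]
        P[fun ω => b (Z r ω) | sigmaOf Z {s, t}]

/-- The two-sided transition function `Q(x, t; F, r; y, s)` built from the heat kernel. -/
def transition {d : ℕ} (D : Set (E d)) (g : E d → ℝ → E d → ℝ) (x : E d) (t : ℝ) (F : Set (E d))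
    (r : ℝ) (y : E d) (s : ℝ) : ℝ :=
  ∫ z in F ∩ D, g x (t - r) z * g z (r - s) y / g x (t - s) y

/-- The (signed) measure `μ(G) = ∫_G φ(x) g(x, T, y) ψ(y) dx dy` on pairs of points of `D`. -/
def endpointMeasure {d : ℕ} (D : Set (E d)) (g : E d → ℝ → E d → ℝ) (T : ℝ) (φ ψ : E d → ℝ)
    (G : Set (E d × E d)) : ℝ :=
  ∫ z in G ∩ D ×ˢ D, φ z.1 * g z.1 T z.2 * ψ z.2

/-- `Z` is the Bernstein process with two-sided transition function `Q` whose pair of endpoints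
`(Z_0, Z_T)` is distributed according to the mixture `∑ₘ pₘ μₘ`. -/
structure IsMixedProcess [MeasurableSpace Ω] {d : ℕ} (D : Set (E d)) (T : ℝ)
    (g : E d → ℝ → E d → ℝ) (p : (Fin d → ℕ) → ℝ) (φ ψ : (Fin d → ℕ) → E d → ℝ)
    (P : Measure Ω) (Z : ℝ → Ω → E d) : Prop where
  isBernstein : IsBernsteinProcess D T P Z
  transition_eq : ∀ s r t : ℝ, 0 ≤ s → s < r → r < t → t ≤ T →
    ∀ F : Set (E d), MeasurableSet F →
      P[(Z r ⁻¹' F).indicator (fun _ => (1 : ℝ)) | sigmaOf Z {s, t}] =ᵐ[P]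
        fun ω => transition D g (Z t ω) t F r (Z s ω) s
  endpoints : ∀ G : Set (E d × E d), MeasurableSet G →
    HasSum (fun m => p m * endpointMeasure D g T (φ m) (ψ m) G)
      (P.real {ω | (Z 0 ω, Z T ω) ∈ G})

end Bernstein

end

/-! Write ⟨x, y⟩ for the inner product that is linear in y. The operator R(t) = ∑ pₘ ⟨uₘ, ·⟩ vₘ is
nuclear: ∑ pₘ ‖uₘ‖ ‖vₘ‖ is finite, because the data are bounded on a set of finite volume and the
semigroup consists of bounded operators. A nuclear operator A = ∑ ⟨aᵢ, ·⟩ bᵢ has trace ∑ ⟨aᵢ, bᵢ⟩ in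
every orthonormal basis (`hasSum_inner_of_nuclear`), and |A| = WA for a contraction W is nuclear as
well, so that A is trace class (`hasTrace_of_nuclear`). The pairing ⟨uₘ(t), vₙ(t)⟩ = ⟨φₘ, exp(-TH)
ψₙ⟩ = δₘₙ does not depend on t; it yields the traces of R and R² and the eigenvectors vₘ.
Composition with B again gives a nuclear operator, of trace ∑ pₘ ⟨uₘ, B vₘ⟩.

Linearity, boundedness, symmetry and the semigroup law are not part of the definition of the heat
kernel. All of them follow from the fact that r ↦ ⟨w(s+r), z(t-r)⟩ is constant for two solutions w,
z (`inner_eq_of_solves`).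

The probabilistic formula requires the law of Z_t. Given the endpoints x, y, the transition function
is the bridge mass ∫_F g(z,t,x) g(z,T-t,y) dz divided by g(x,T,y). Against the endpoint density ∑ pₘ
φₘ(x) g(x,T,y) ψₘ(y) the denominator cancels (`kernel_mul_transition`), and Fubini turns the bridge
mass tested against φₘ ⊗ ψₘ into ∫_F uₘ vₘ. So Z_t has density ∑ pₘ uₘ vₘ, and the expectation of
b(Z_t) is the trace already computed.

Both Fubini and the cancellation at zeros of g rest on g ≥ 0. This is positivity preservation:
testing the equation with the negative part of the solution and using the lower bound of V gives a
Gronwall inequality for the squared norm of that negative part (`negL2_eq_zero_of_solves`). -/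

namespace Bernstein

/-! ### Nuclear operators are trace class -/

section Nuclear

universe u

variable {H : Type u} [NormedAddCommGroup H] [InnerProductSpace ℂ H]

/-- Cauchy-Schwarz for finite sums followed by Bessel's inequality for x and for y. It gives the
absolute convergence needed to exchange sums in the trace. -/
theorem sum_norm_inner_mul_norm_inner_le {ι : Type*} (h : HilbertBasis ι ℂ H) (x y : H)
    (s : Finset ι) : ∑ n ∈ s, ‖(inner ℂ x (h n) : ℂ)‖ * ‖(inner ℂ (h n) y : ℂ)‖ ≤ ‖x‖ * ‖y‖ := by
  refine (Real.sum_mul_le_sqrt_mul_sqrt s _ _).trans ?_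
  have hb : ∀ z : H, √(∑ n ∈ s, ‖(inner ℂ (h n) z : ℂ)‖ ^ 2) ≤ ‖z‖ := fun z =>
    Real.sqrt_le_iff.2 ⟨norm_nonneg _, h.orthonormal.sum_inner_products_le z⟩
  simp_rw [norm_inner_symm x]
  exact mul_le_mul (hb x) (hb y) (Real.sqrt_nonneg _) (norm_nonneg _)

variable {κ : Type*} {a b : κ → H}

/-- The trace of a nuclear operator `∑ᵢ (·, aᵢ) bᵢ` in an orthonormal basis. -/
theorem hasSum_inner_of_nuclear (hab : Summable fun i => ‖a i‖ * ‖b i‖) {A : H →L[ℂ] H}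
    (hA : ∀ f, HasSum (fun i => (inner ℂ (a i) f : ℂ) • b i) (A f)) {ι : Type*}
    (h : HilbertBasis ι ℂ H) :
    HasSum (fun n => (inner ℂ (h n) (A (h n)) : ℂ)) (∑' i, inner ℂ (a i) (b i)) := by
  -- Fubini for this absolutely summable double family: summed over the basis first it gives ∑ ⟨aᵢ,
  -- bᵢ⟩ by Parseval, summed over i first it gives the diagonal entries of A.
  let F : κ × ι → ℂ := fun q => inner ℂ (a q.1) (h q.2) * inner ℂ (h q.2) (b q.1)
  have hbound : ∀ i, ∀ s : Finset ι, ∑ n ∈ s, ‖F (i, n)‖ ≤ ‖a i‖ * ‖b i‖ := fun i s => by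
    simpa [F] using sum_norm_inner_mul_norm_inner_le h (a i) (b i) s
  have hsn : ∀ i, Summable fun n => ‖F (i, n)‖ := fun i =>
    summable_of_sum_le (fun _ => norm_nonneg _) (hbound i)
  have hF : Summable F := by
    refine Summable.of_norm ((summable_prod_of_nonneg fun _ => norm_nonneg _).2 ⟨hsn, ?_⟩)
    exact Summable.of_nonneg_of_le (fun i => tsum_nonneg fun _ => norm_nonneg _)
      (fun i => (hsn i).tsum_le_of_sum_le (hbound i)) hab
  have h1 : HasSum F (∑' i, inner ℂ (a i) (b i)) := by
    have := hF.hasSum.prod_fiberwise fun i => h.hasSum_inner_mul_inner (a i) (b i)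
    rw [this.tsum_eq]
    exact hF.hasSum
  have h2 : HasSum (F ∘ Prod.swap) (∑' i, inner ℂ (a i) (b i)) :=
    (Equiv.prodComm ι κ).hasSum_iff.2 h1
  refine h2.prod_fiberwise fun n => ?_
  have := (hA (h n)).mapL (innerSL ℂ (h n))
  simpa [F, inner_smul_right] using this

theorem summable_inner_comp_of_nuclear (hab : Summable fun i => ‖a i‖ * ‖b i‖)
    (B : H →L[ℂ] H) : Summable fun i => (inner ℂ (a i) (B (b i)) : ℂ) := by
  refine Summable.of_norm_bounded (hab.mul_left ‖B‖) fun i => ?_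
  refine (norm_inner_le_norm _ _).trans ?_
  rw [mul_left_comm]
  exact mul_le_mul_of_nonneg_left (B.le_opNorm _) (norm_nonneg _)

variable [CompleteSpace H]

theorem norm_cfcAbs_apply (A : H →L[ℂ] H) (f : H) : ‖CFC.abs A f‖ = ‖A f‖ := by
  have hsa : star (CFC.abs A) = CFC.abs A := (CFC.abs_nonneg A).isSelfAdjoint.star_eq
  have h : inner ℂ (CFC.abs A f) (CFC.abs A f) = inner ℂ (A f) (A f) := by
    rw [← ContinuousLinearMap.adjoint_inner_right, ← ContinuousLinearMap.adjoint_inner_right A,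
      ← ContinuousLinearMap.star_eq_adjoint, ← ContinuousLinearMap.star_eq_adjoint, hsa]
    have := congrArg (fun B : H →L[ℂ] H => B f) (CFC.abs_mul_abs A)
    exact congrArg (inner ℂ f) this
  rw [inner_self_eq_norm_sq_to_K, inner_self_eq_norm_sq_to_K] at h
  have h' : ‖CFC.abs A f‖ ^ 2 = ‖A f‖ ^ 2 := by exact_mod_cast h
  exact (sq_eq_sq₀ (norm_nonneg _) (norm_nonneg _)).1 h'

/-- An operator dominated in norm by `A` factors through `A` by a contraction. -/
theorem exists_contraction_comp_eq {A B : H →L[ℂ] H} (h : ∀ f, ‖B f‖ ≤ ‖A f‖) :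
    ∃ W : H →L[ℂ] H, (∀ f, ‖W f‖ ≤ ‖f‖) ∧ ∀ f, W (A f) = B f := by
  let K : Submodule ℂ H := (LinearMap.range (A : H →ₗ[ℂ] H)).topologicalClosure
  have hK : ∀ f, A f ∈ K := fun f =>
    Submodule.le_topologicalClosure _ (LinearMap.mem_range_self (A : H →ₗ[ℂ] H) f)
  have : CompleteSpace K :=
    (Submodule.isClosed_topologicalClosure _).completeSpace_coe
  let e : H →ₗ[ℂ] K := (A : H →ₗ[ℂ] H).codRestrict K hK
  have he : DenseRange e := by
    intro y
    have hy : (y : H) ∈ closure (LinearMap.range (A : H →ₗ[ℂ] H) : Set H) := y.2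
    rw [Metric.mem_closure_iff] at hy ⊢
    intro ε hε
    obtain ⟨_, ⟨f, rfl⟩, hf⟩ := hy ε hε
    exact ⟨e f, ⟨f, rfl⟩, hf⟩
  have hn : ∀ f, ‖(B : H →ₗ[ℂ] H) f‖ ≤ 1 * ‖e f‖ := fun f => by
    rw [one_mul]; exact h f
  -- The map A f ↦ B f is well defined and contractive on the range of A. It extends to the closure
  -- K by density, and the orthogonal projection makes it zero on the complement.
  refine ⟨((B : H →ₗ[ℂ] H).extendOfNorm e) ∘L K.orthogonalProjectionOnto, fun f => ?_, fun f => ?_⟩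
  · refine (LinearMap.norm_extendOfNorm_apply_le he 1 hn _).trans ?_
    rw [one_mul]
    exact K.norm_orthogonalProjectionOnto_apply_le f
  · have : K.orthogonalProjectionOnto (A f) = e f :=
      Submodule.orthogonalProjectionOnto_mem_subspace_eq_self (e f)
    rw [ContinuousLinearMap.comp_apply, this]
    exact LinearMap.extendOfNorm_eq he ⟨1, hn⟩ f

theorem hasTrace_of_nuclear (hab : Summable fun i => ‖a i‖ * ‖b i‖) {A : H →L[ℂ] H}
    (hA : ∀ f, HasSum (fun i => (inner ℂ (a i) f : ℂ) • b i) (A f)) {τ : ℂ}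
    (hτ : HasSum (fun i => (inner ℂ (a i) (b i) : ℂ)) τ) : HasTrace A τ := by
  refine ⟨fun ι h => ?_, fun ι h => hτ.tsum_eq ▸ hasSum_inner_of_nuclear hab hA h⟩
  -- This replaces the polar decomposition: |A| = WA is nuclear with the vectors aᵢ and W bᵢ, and
  -- its trace series converges in every basis.
  obtain ⟨W, hW, hWA⟩ := exists_contraction_comp_eq fun f => (norm_cfcAbs_apply A f).le
  have hab' : Summable fun i => ‖a i‖ * ‖W (b i)‖ :=
    Summable.of_nonneg_of_le (fun i => by positivity)
      (fun i => mul_le_mul_of_nonneg_left (hW _) (norm_nonneg _)) hab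
  have hA' : ∀ f, HasSum (fun i => (inner ℂ (a i) f : ℂ) • W (b i)) (CFC.abs A f) := fun f => by
    have := (hA f).mapL W
    simpa [hWA] using this
  exact (Complex.reCLM.hasSum (hasSum_inner_of_nuclear hab' hA' h)).summable

theorem exists_nuclear (hab : Summable fun i => ‖a i‖ * ‖b i‖) :
    ∃ A : H →L[ℂ] H, ∀ f, HasSum (fun i => (inner ℂ (a i) f : ℂ) • b i) (A f) := by
  have hs : Summable fun i => (innerSL ℂ (a i)).smulRight (b i) := by
    refine Summable.of_norm ?_
    simpa [ContinuousLinearMap.norm_smulRight_apply] using hab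
  refine ⟨∑' i, (innerSL ℂ (a i)).smulRight (b i), fun f => ?_⟩
  simpa using hs.hasSum.mapL (ContinuousLinearMap.apply ℂ H f)

/-- Composition of a nuclear operator with a bounded operator. -/
theorem hasTrace_nuclear_comp (hab : Summable fun i => ‖a i‖ * ‖b i‖) {A : H →L[ℂ] H}
    (hA : ∀ f, HasSum (fun i => (inner ℂ (a i) f : ℂ) • b i) (A f)) (B : H →L[ℂ] H) {τ : ℂ}
    (hτ : HasSum (fun i => (inner ℂ (a i) (B (b i)) : ℂ)) τ) : HasTrace (A ∘L B) τ := by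
  refine hasTrace_of_nuclear (a := fun i => ContinuousLinearMap.adjoint B (a i)) (b := b) ?_ ?_ ?_
  · refine Summable.of_nonneg_of_le (fun i => by positivity) (fun i => ?_)
      (hab.mul_left ‖ContinuousLinearMap.adjoint B‖)
    rw [← mul_assoc]
    exact mul_le_mul_of_nonneg_right (ContinuousLinearMap.le_opNorm _ _) (norm_nonneg _)
  · intro f
    simpa [ContinuousLinearMap.adjoint_inner_left] using hA (B f)
  · simpa [ContinuousLinearMap.adjoint_inner_left] using hτ

end Nuclear

/-! ### The heat semigroup -/

/-- A family of bounded operators `S t`, `t ∈ [0, T]`, that solves the evolution equation of the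
heat kernel `g`. -/
structure IsHeatSemigroup {d : ℕ} (D : Set (E d)) (V : E d → ℝ) (T : ℝ) (g : E d → ℝ → E d → ℝ)
    (S : ℝ → L2 D →L[ℂ] L2 D) : Prop where
  zero : ∀ f, S 0 f = f
  continuousOn : ∀ f, ContinuousOn (fun t => S t f) (Icc 0 T)
  solves : ∀ f, ∀ t ∈ Ioc 0 T, ∃ h : L2 D, SchrodingerGraph D V (S t f) h ∧
    HasDerivWithinAt (fun t => S t f) (-h) (Icc 0 T) t
  kernel : ∀ f, ∀ t ∈ Ioc 0 T, ∀ᵐ x ∂(volume.restrict D),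
    Integrable (fun y => (g x t y : ℂ) * f y) (volume.restrict D) ∧
      S t f x = ∫ y in D, (g x t y : ℂ) * f y
  inner_add : ∀ f k, ∀ s t, 0 ≤ s → 0 ≤ t → s + t ≤ T →
    (inner ℂ (S (s + t) f) k : ℂ) = inner ℂ (S s f) (S t k)

variable {d : ℕ} {D : Set (E d)} {V : E d → ℝ} {T : ℝ} {g : E d → ℝ → E d → ℝ}

/-- The quadratic form is hermitian: each element of the graph is tested with the other one. -/
theorem SchrodingerGraph.symm {u h u' h' : L2 D} (hu : SchrodingerGraph D V u h)
    (hu' : SchrodingerGraph D V u' h') : (inner ℂ h u' : ℂ) = inner ℂ u h' := by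
  obtain ⟨G, hG, H⟩ := hu
  obtain ⟨G', hG', H'⟩ := hu'
  rw [← inner_conj_symm, H u' G' hG', H' u G hG, map_add, map_mul, map_sum, ← integral_conj]
  simp only [inner_conj_symm]
  congr 1
  · simp [Complex.conj_ofNat]
  · refine integral_congr_ae (.of_forall fun x => ?_)
    simp only [map_mul, Complex.conj_conj, Complex.conj_ofReal]
    ring

/-- The derivative of r ↦ ⟨w(s+r), z(t-r)⟩ is -⟨h, z⟩ + ⟨w, k⟩, with h and k the images of w and z
under the operator, and it vanishes by symmetry. Comparing r = 0 and r = t gives the claim. -/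
theorem inner_eq_of_solves {w z : ℝ → L2 D} (hw : ContinuousOn w (Icc 0 T))
    (hz : ContinuousOn z (Icc 0 T))
    (hw' : ∀ t ∈ Ioc 0 T, ∃ h : L2 D, SchrodingerGraph D V (w t) h ∧
      HasDerivWithinAt w (-h) (Icc 0 T) t)
    (hz' : ∀ t ∈ Ioc 0 T, ∃ h : L2 D, SchrodingerGraph D V (z t) h ∧
      HasDerivWithinAt z (-h) (Icc 0 T) t)
    {s t : ℝ} (hs : 0 ≤ s) (ht : 0 ≤ t) (hst : s + t ≤ T) :
    (inner ℂ (w (s + t)) (z 0) : ℂ) = inner ℂ (w s) (z t) := by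
  rcases ht.eq_or_lt with rfl | ht0
  · simp
  let F : ℝ → ℂ := fun r => inner ℂ (w (s + r)) (z (t - r))
  have hF : ContinuousOn F (Icc 0 t) := by
    refine ContinuousOn.inner (hw.comp (by fun_prop) ?_) (hz.comp (by fun_prop) ?_)
    · intro r hr; constructor <;> linarith [hr.1, hr.2]
    · intro r hr; constructor <;> linarith [hr.1, hr.2]
  have hd : ∀ r ∈ Ioo 0 t, HasDerivAt F 0 r := by
    intro r hr
    have h1 : s + r ∈ Ioo 0 T := ⟨by linarith [hr.1], by linarith [hr.2]⟩
    have h2 : t - r ∈ Ioo 0 T := ⟨by linarith [hr.2], by linarith [hr.1]⟩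
    obtain ⟨h, hh, hhd⟩ := hw' _ ⟨h1.1, h1.2.le⟩
    obtain ⟨k, hk, hkd⟩ := hz' _ ⟨h2.1, h2.2.le⟩
    have e1 : HasDerivAt (fun r => w (s + r)) (-h) r := by
      exact (hhd.hasDerivAt (Icc_mem_nhds h1.1 h1.2)).comp_const_add s r
    have e2 : HasDerivAt (fun r => z (t - r)) k r := by
      simpa only [neg_neg] using (hkd.hasDerivAt (Icc_mem_nhds h2.1 h2.2)).comp_const_sub t r
    have := e1.inner ℂ e2
    rwa [inner_neg_left, hh.symm hk, add_neg_cancel] at this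
  -- At r = 0 the time s + r may be 0, where no derivative is available. Constancy is therefore
  -- proved on [ε, t] and carried to 0 by continuity.
  have hc : ∀ ε ∈ Ioc 0 t, F ε = F t := by
    intro ε hε
    refine (constant_of_has_deriv_right_zero (hF.mono (Icc_subset_Icc_left hε.1.le))
      (fun r hr => (hd r ⟨hε.1.trans_le hr.1, hr.2⟩).hasDerivWithinAt) t ⟨hε.2, le_rfl⟩).symm
  have hlim : Tendsto F (𝓝[Ioc 0 t] 0) (𝓝 (F 0)) :=
    (hF 0 ⟨le_rfl, ht⟩).mono Ioc_subset_Icc_self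
  have : (𝓝[Ioc 0 t] (0 : ℝ)).NeBot := by
    rw [nhdsWithin_Ioc_eq_nhdsGT ht0]; infer_instance
  have hlim' : Tendsto F (𝓝[Ioc 0 t] 0) (𝓝 (F t)) :=
    tendsto_const_nhds.congr' (eventually_nhdsWithin_of_forall fun ε hε => (hc ε hε).symm)
  have := tendsto_nhds_unique hlim' hlim
  simpa [F] using this

theorem IsHeatKernel.exists_semigroup (hT : 0 ≤ T) (hg : IsHeatKernel D V T g) :
    ∃ S, IsHeatSemigroup D V T g S := by
  choose w w0 wc hw using hg.solves
  have key : ∀ f k s t, 0 ≤ s → 0 ≤ t → s + t ≤ T →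
      (inner ℂ (w f (s + t)) k : ℂ) = inner ℂ (w f s) (w k t) := by
    intro f k s t hs ht hst
    have := inner_eq_of_solves (wc f) (wc k) (fun t ht => (hw f t ht).1)
      (fun t ht => (hw k t ht).1) hs ht hst
    rwa [w0] at this
  have symm : ∀ t ∈ Icc 0 T, ∀ f k, (inner ℂ (w f t) k : ℂ) = inner ℂ f (w k t) := by
    intro t ht f k
    have := key f k 0 t le_rfl ht.1 (by simpa using ht.2)
    rwa [w0, zero_add] at this
  have hlin : ∀ t ∈ Icc 0 T, ∃ A : L2 D →L[ℂ] L2 D, ∀ f, A f = w f t := by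
    intro t ht
    let A : L2 D →ₗ[ℂ] L2 D :=
      { toFun := fun f => w f t
        map_add' := fun f k => ext_inner_right ℂ fun z => by
          rw [symm t ht, inner_add_left, inner_add_left, symm t ht, symm t ht]
        map_smul' := fun c f => ext_inner_right ℂ fun z => by
          rw [symm t ht, RingHom.id_apply, inner_smul_left, inner_smul_left, symm t ht] }
    -- Symmetry alone forces the solution to depend linearly on its initial value; continuity is
    -- then the Hellinger-Toeplitz theorem.
    have hA : A.IsSymmetric := fun f k => symm t ht f k
    exact ⟨⟨A, hA.continuous⟩, fun f => rfl⟩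
  choose! S hS using hlin
  have hEq : ∀ f, EqOn (fun t => S t f) (w f) (Icc 0 T) := fun f t ht => hS t ht f
  refine ⟨S, ?_, ?_, ?_, ?_, ?_⟩
  · exact fun f => (hEq f ⟨le_rfl, hT⟩).trans (w0 f)
  · exact fun f => (wc f).congr (hEq f)
  · intro f t ht
    have ht' := Ioc_subset_Icc_self ht
    obtain ⟨h, h1, h2⟩ := (hw f t ht).1
    exact ⟨h, by rwa [hS t ht'], h2.congr (hEq f) (hEq f ht')⟩
  · intro f t ht
    rw [hS t (Ioc_subset_Icc_self ht)]
    exact (hw f t ht).2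
  · intro f k s t hs ht hst
    rw [hS _ ⟨by linarith, hst⟩, hS s ⟨hs, by linarith⟩, hS t ⟨ht, by linarith⟩, key f k s t hs ht hst]

namespace IsHeatSemigroup

variable {S : ℝ → L2 D →L[ℂ] L2 D}

theorem inner_symm (hS : IsHeatSemigroup D V T g S) {t : ℝ} (ht : t ∈ Icc 0 T) (f k : L2 D) :
    (inner ℂ (S t f) k : ℂ) = inner ℂ f (S t k) := by
  have := hS.inner_add f k 0 t le_rfl ht.1 (by simpa using ht.2)
  rwa [hS.zero, zero_add] at this

end IsHeatSemigroup

/-! ### Positivity preservation -/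

theorem tendsto_eLpNorm_two_zero_of_dominated {α F : Type*} [MeasurableSpace α] {μ : Measure α}
    [NormedAddCommGroup F] {f : ℕ → α → F} {b : α → F} (hf : ∀ n, AEStronglyMeasurable (f n) μ)
    (hb : MemLp b 2 μ) (hfb : ∀ n, ∀ᵐ x ∂μ, ‖f n x‖ ≤ ‖b x‖)
    (hlim : ∀ᵐ x ∂μ, Tendsto (fun n => f n x) atTop (𝓝 0)) :
    Tendsto (fun n => eLpNorm (f n) 2 μ) atTop (𝓝 0) := by
  have h2 : (2 : ℝ≥0∞).toReal = 2 := by simp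
  have key : Tendsto (fun n => ∫⁻ x, ‖f n x‖ₑ ^ (2 : ℝ) ∂μ) atTop (𝓝 (∫⁻ _, 0 ∂μ)) := by
    refine tendsto_lintegral_of_dominated_convergence' (fun x => ‖b x‖ₑ ^ (2 : ℝ))
      (fun n => (hf n).enorm.pow_const _) (fun n => ?_) ?_ ?_
    · filter_upwards [hfb n] with x hx
      exact ENNReal.rpow_le_rpow (enorm_le_iff_norm_le.2 hx) (by norm_num)
    · have := lintegral_rpow_enorm_lt_top_of_eLpNorm_lt_top (by norm_num) (by norm_num) hb.2
      rw [h2] at this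
      exact this.ne
    · filter_upwards [hlim] with x hx
      have := (ENNReal.continuous_rpow_const (y := 2)).tendsto _ |>.comp hx.enorm
      simpa [Function.comp_def] using this
  have := (ENNReal.continuous_rpow_const (y := 1 / 2)).tendsto _ |>.comp key
  simpa [eLpNorm_eq_lintegral_rpow_enorm_toReal, Function.comp_def] using this

variable {d : ℕ} {D : Set (E d)} {V : E d → ℝ} {T : ℝ} {g : E d → ℝ → E d → ℝ}

/-- The chain rule in `H¹(D)` for a `C¹` contraction applied to the real part. -/
theorem HasSobolevGradient.comp_re (hD : IsOpen D) {u : L2 D} {G : Fin d → L2 D}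
    (hu : HasSobolevGradient D u G) {θ : ℝ → ℝ} (hθ : ContDiff ℝ 1 θ) (hθ' : ∀ s, |deriv θ s| ≤ 1)
    {v : L2 D} {K : Fin d → L2 D} (hv : v =ᵐ[volume.restrict D] fun x => (θ (u x).re : ℂ))
    (hK : ∀ i, K i =ᵐ[volume.restrict D] fun x => (deriv θ (u x).re * (G i x).re : ℝ)) :
    HasSobolevGradient D v K := by
  obtain ⟨w, hwc, hwu, hwG⟩ := hu
  have hlip : ∀ s t, |θ s - θ t| ≤ |s - t| := fun s t => by
    have := lipschitzWith_of_nnnorm_deriv_le (C := 1) (hθ.differentiable one_ne_zero)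
      (fun s => by simpa [← NNReal.coe_le_coe] using hθ' s)
    simpa [Real.dist_eq] using this.dist_le_mul s t
  have hθc : Continuous (deriv θ) := hθ.continuous_deriv le_rfl
  have hwm : ∀ n, AEStronglyMeasurable (w n) (volume.restrict D) := fun n =>
    (hwc n).continuousOn.aestronglyMeasurable hD.measurableSet
  have hdm : ∀ n i, AEStronglyMeasurable
      (fun x => fderiv ℝ (w n) x (EuclideanSpace.single i 1)) (volume.restrict D) := fun n i =>
    (((hwc n).continuousOn_fderiv_of_isOpen hD le_rfl).clm_apply
      continuousOn_const).aestronglyMeasurable hD.measurableSet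
  -- Along a subsequence the approximants also converge almost everywhere, as the continuity of θ'
  -- will require.
  obtain ⟨ns, hns, hae⟩ := (tendstoInMeasure_of_tendsto_eLpNorm two_ne_zero hwm
    (Lp.aestronglyMeasurable u) hwu).exists_seq_tendsto_ae
  refine ⟨fun n x => (θ (w (ns n) x).re : ℂ), fun n => ?_, ?_, fun i => ?_⟩
  · exact Complex.ofRealCLM.contDiff.comp_contDiffOn
      (hθ.comp_contDiffOn (Complex.reCLM.contDiff.comp_contDiffOn (hwc (ns n))))
  · refine tendsto_of_tendsto_of_tendsto_of_le_of_le tendsto_const_nhds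
      (hwu.comp hns.tendsto_atTop) (fun _ => zero_le) fun n => ?_
    refine eLpNorm_mono_ae ?_
    filter_upwards [hv] with x hx
    rw [hx, ← Complex.ofReal_sub, Complex.norm_real, Real.norm_eq_abs]
    refine (hlip _ _).trans ?_
    rw [← Complex.sub_re]
    exact Complex.abs_re_le_norm _
  · have hder : ∀ n, ∀ x ∈ D, fderiv ℝ (fun x => (θ (w (ns n) x).re : ℂ)) x
        (EuclideanSpace.single i 1) = (deriv θ (w (ns n) x).re *
          (fderiv ℝ (w (ns n)) x (EuclideanSpace.single i 1)).re : ℝ) := by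
      intro n x hx
      have h1 : HasFDerivAt (w (ns n)) (fderiv ℝ (w (ns n)) x) x :=
        (((hwc (ns n)).differentiableOn one_ne_zero).differentiableAt
          (hD.mem_nhds hx)).hasFDerivAt
      have h2 := Complex.reCLM.hasFDerivAt.comp x h1
      have h3 := (hθ.differentiable one_ne_zero).differentiableAt.hasDerivAt.comp_hasFDerivAt x h2
      have h4 := Complex.ofRealCLM.hasFDerivAt.comp x h3
      have h5 := h4.fderiv
      simp only [Function.comp_def] at h5
      rw [show (fun x => (θ (w (ns n) x).re : ℂ)) =
        fun x => Complex.ofRealCLM (θ (Complex.reCLM (w (ns n) x))) from rfl, h5]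
      simp
    -- The error in the gradient splits as θ'(wₙ)(∂wₙ - G) + (θ'(wₙ) - θ'(u))G, in real parts. The
    -- first term `q` is small since |θ'| ≤ 1; the second, `r`, is dominated by 2|G| and tends to 0
    -- almost everywhere.
    let r : ℕ → E d → ℂ := fun n x =>
      ((deriv θ (w (ns n) x).re - deriv θ (u x).re) * (G i x).re : ℝ)
    have hr : Tendsto (fun n => eLpNorm (r n) 2 (volume.restrict D)) atTop (𝓝 0) := by
      refine tendsto_eLpNorm_two_zero_of_dominated (b := fun x => (2 : ℂ) * G i x) (fun n => ?_)
        ((Lp.memLp (G i)).const_mul 2) (fun n => .of_forall fun x => ?_) ?_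
      · refine Complex.continuous_ofReal.comp_aestronglyMeasurable
          (((hθc.comp_aestronglyMeasurable
            (Complex.continuous_re.comp_aestronglyMeasurable (hwm _))).sub
            (hθc.comp_aestronglyMeasurable (Complex.continuous_re.comp_aestronglyMeasurable
              (Lp.aestronglyMeasurable u)))).mul
            (Complex.continuous_re.comp_aestronglyMeasurable (Lp.aestronglyMeasurable (G i))))
      · simp only [r]
        rw [Complex.norm_real, Real.norm_eq_abs, abs_mul, norm_mul, Complex.norm_two]
        refine mul_le_mul ?_ (Complex.abs_re_le_norm _) (abs_nonneg _) zero_le_two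
        exact (abs_sub _ _).trans (by linarith [hθ' (w (ns n) x).re, hθ' (u x).re])
      · filter_upwards [hae] with x hx
        have h1 : Tendsto (fun n => deriv θ (w (ns n) x).re) atTop (𝓝 (deriv θ (u x).re)) :=
          (hθc.tendsto _).comp ((Complex.continuous_re.tendsto _).comp hx)
        have h2 := (Complex.continuous_ofReal.tendsto _).comp
          ((h1.sub_const (deriv θ (u x).re)).mul_const (G i x).re)
        simpa [r, Function.comp_def] using h2
    have hsum := (((hwG i).comp hns.tendsto_atTop).add hr)
    rw [add_zero] at hsum
    refine tendsto_of_tendsto_of_tendsto_of_le_of_le tendsto_const_nhds hsum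
      (fun _ => zero_le) fun n => ?_
    let q : E d → ℂ := fun x => (deriv θ (w (ns n) x).re *
      (fderiv ℝ (w (ns n)) x (EuclideanSpace.single i 1) - G i x).re : ℝ)
    have hq : AEStronglyMeasurable q (volume.restrict D) :=
      Complex.continuous_ofReal.comp_aestronglyMeasurable
        ((hθc.comp_aestronglyMeasurable
          (Complex.continuous_re.comp_aestronglyMeasurable (hwm _))).mul
          (Complex.continuous_re.comp_aestronglyMeasurable
            ((hdm (ns n) i).sub (Lp.aestronglyMeasurable (G i)))))
    have hrm : AEStronglyMeasurable (r n) (volume.restrict D) :=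
      Complex.continuous_ofReal.comp_aestronglyMeasurable
          (((hθc.comp_aestronglyMeasurable
            (Complex.continuous_re.comp_aestronglyMeasurable (hwm _))).sub
            (hθc.comp_aestronglyMeasurable (Complex.continuous_re.comp_aestronglyMeasurable
              (Lp.aestronglyMeasurable u)))).mul
            (Complex.continuous_re.comp_aestronglyMeasurable (Lp.aestronglyMeasurable (G i))))
    have hdec : eLpNorm (fun x => fderiv ℝ (fun x => (θ (w (ns n) x).re : ℂ)) x
        (EuclideanSpace.single i 1) - K i x) 2 (volume.restrict D) =
        eLpNorm (q + r n) 2 (volume.restrict D) := by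
      refine eLpNorm_congr_ae ?_
      filter_upwards [hK i, ae_restrict_mem hD.measurableSet] with x hx hxD
      simp only [hder n x hxD, hx, Pi.add_apply, q, r, ← Complex.ofReal_sub, ← Complex.ofReal_add,
        Complex.sub_re]
      congr 1
      ring
    rw [hdec]
    refine (eLpNorm_add_le hq hrm one_le_two).trans (add_le_add_left (eLpNorm_mono fun x => ?_) _)
    simp only [q]
    rw [Complex.norm_real, Real.norm_eq_abs, abs_mul]
    refine (mul_le_of_le_one_left (abs_nonneg _) (hθ' _)).trans ?_
    exact Complex.abs_re_le_norm _

/-- A `C¹` approximation of the negative part. -/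
noncomputable def smoothNeg (ε s : ℝ) : ℝ := √(ε ^ 2 + min s 0 ^ 2) - ε

/-- Squaring removes the kink of min s 0 at the origin, which is what makes `smoothNeg` continuously
differentiable. -/
theorem hasDerivAt_min_zero_sq (s : ℝ) : HasDerivAt (fun s : ℝ => min s 0 ^ 2) (2 * min s 0) s := by
  rcases lt_trichotomy s 0 with h | h | h
  · have : (fun s : ℝ => min s 0 ^ 2) =ᶠ[𝓝 s] fun s => s ^ 2 := by
      filter_upwards [gt_mem_nhds h] with r hr
      rw [min_eq_left hr.le]
    rw [min_eq_left h.le]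
    simpa using (hasDerivAt_pow 2 s).congr_of_eventuallyEq this
  · subst h
    rw [min_self, mul_zero, hasDerivAt_iff_isLittleO]
    simp only [min_self, smul_zero, sub_zero, ne_eq, OfNat.ofNat_ne_zero, not_false_eq_true,
      zero_pow]
    have h1 : (fun s : ℝ => min s 0 ^ 2) =O[𝓝 0] fun s => s ^ 2 := by
      refine Asymptotics.isBigO_of_le _ fun r => ?_
      rw [norm_pow, norm_pow]
      refine pow_le_pow_left₀ (norm_nonneg _) ?_ 2
      rcases le_total r 0 with hr | hr <;> simp [hr]
    exact h1.trans_isLittleO (by simpa using Asymptotics.isLittleO_pow_id (n := 2) one_lt_two)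
  · have : (fun s : ℝ => min s 0 ^ 2) =ᶠ[𝓝 s] fun _ => 0 := by
      filter_upwards [lt_mem_nhds h] with r hr
      rw [min_eq_right hr.le]; simp
    rw [min_eq_right h.le, mul_zero]
    exact (hasDerivAt_const s 0).congr_of_eventuallyEq this

theorem hasDerivAt_smoothNeg {ε : ℝ} (hε : 0 < ε) (s : ℝ) :
    HasDerivAt (smoothNeg ε) (min s 0 / √(ε ^ 2 + min s 0 ^ 2)) s := by
  have := (((hasDerivAt_min_zero_sq s).const_add (ε ^ 2)).sqrt (by positivity)).sub_const ε
  rwa [mul_div_mul_left _ _ two_ne_zero] at this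

theorem deriv_smoothNeg {ε : ℝ} (hε : 0 < ε) :
    deriv (smoothNeg ε) = fun s => min s 0 / √(ε ^ 2 + min s 0 ^ 2) :=
  funext fun s => (hasDerivAt_smoothNeg hε s).deriv

theorem contDiff_smoothNeg {ε : ℝ} (hε : 0 < ε) : ContDiff ℝ 1 (smoothNeg ε) := by
  refine contDiff_one_iff_deriv.2 ⟨fun s => (hasDerivAt_smoothNeg hε s).differentiableAt, ?_⟩
  rw [deriv_smoothNeg hε]
  refine Continuous.div (by fun_prop) (by fun_prop) fun s => ?_
  positivity

theorem abs_deriv_smoothNeg_le {ε : ℝ} (hε : 0 < ε) (s : ℝ) : |deriv (smoothNeg ε) s| ≤ 1 := by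
  rw [deriv_smoothNeg hε, abs_div, abs_of_nonneg (Real.sqrt_nonneg _),
    div_le_one (by positivity)]
  exact Real.abs_le_sqrt (by nlinarith)

theorem deriv_smoothNeg_nonpos {ε : ℝ} (hε : 0 < ε) (s : ℝ) : deriv (smoothNeg ε) s ≤ 0 := by
  rw [deriv_smoothNeg hε]
  exact div_nonpos_of_nonpos_of_nonneg (min_le_right _ _) (Real.sqrt_nonneg _)

theorem smoothNeg_zero {ε : ℝ} (hε : 0 < ε) : smoothNeg ε 0 = 0 := by
  simp [smoothNeg, Real.sqrt_sq hε.le]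

theorem mul_smoothNeg_nonpos {ε : ℝ} (hε : 0 < ε) (s : ℝ) : s * smoothNeg ε s ≤ 0 := by
  rcases le_total 0 s with h | h
  · have : smoothNeg ε s = smoothNeg ε 0 := by simp [smoothNeg, h]
    rw [this, smoothNeg_zero hε, mul_zero]
  · refine mul_nonpos_of_nonpos_of_nonneg h (sub_nonneg.2 (Real.le_sqrt_of_sq_le ?_))
    nlinarith [sq_nonneg (min s 0)]

/-- With m = min s 0, the root √(ε² + m²) lies between |m| and |m| + ε. The bound is uniform in s,
hence gives L² convergence on a set of finite volume. -/
theorem abs_smoothNeg_sub_le {ε : ℝ} (hε : 0 < ε) (s : ℝ) :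
    |smoothNeg ε s - max (-s) 0| ≤ ε := by
  have h : max (-s) 0 = -min s 0 := by
    rcases le_total 0 s with h | h <;> simp [h]
  have h0 : min s 0 ≤ 0 := min_le_right _ _
  rw [h, smoothNeg]
  generalize min s 0 = m at h0
  have h1 : -m ≤ √(ε ^ 2 + m ^ 2) := Real.le_sqrt_of_sq_le (by nlinarith)
  have h2 : √(ε ^ 2 + m ^ 2) ≤ ε - m := Real.sqrt_le_iff.2 ⟨by linarith, by nlinarith⟩
  rw [abs_le]
  constructor <;> linarith

end Bernstein

namespace Bernstein

/-! ### Energy estimates for the negative part. -/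

variable {d : ℕ} {D : Set (E d)} {V : E d → ℝ} {T : ℝ} {g : E d → ℝ → E d → ℝ}

/-- The form is tested with v = θ(Re u), which |θ'| ≤ 1 and |θ(s)| ≤ |s| place in the form domain.
The gradient part is ½ ∫ θ'(Re u) |Re ∇u|² ≤ 0, and since s θ(s) ≤ 0 the potential V may be replaced
by its lower bound c. -/
theorem SchrodingerGraph.re_inner_comp_le (hD : IsOpen D)
    (hVm : AEStronglyMeasurable V (volume.restrict D)) {c : ℝ}
    (hc : ∀ᵐ x ∂(volume.restrict D), c ≤ V x) {u h : L2 D} (hu : SchrodingerGraph D V u h)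
    {θ : ℝ → ℝ} (hθ : ContDiff ℝ 1 θ) (hθ' : ∀ s, |deriv θ s| ≤ 1)
    (hθn : ∀ s, deriv θ s ≤ 0) (hθm : ∀ s, s * θ s ≤ 0) (hθa : ∀ s, |θ s| ≤ |s|)
    {v : L2 D} (hv : v =ᵐ[volume.restrict D] fun x => (θ (u x).re : ℂ)) :
    (inner ℂ v h : ℂ).re ≤ c * (inner ℂ v u : ℂ).re := by
  obtain ⟨G, ⟨hG, hGi⟩, H⟩ := hu
  have hθc : Continuous (deriv θ) := hθ.continuous_deriv le_rfl
  have hre : ∀ f : L2 D, AEStronglyMeasurable (fun x => (f x).re) (volume.restrict D) := fun f =>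
    Complex.continuous_re.comp_aestronglyMeasurable (Lp.aestronglyMeasurable f)
  have hKm : ∀ i, MemLp (fun x => ((deriv θ (u x).re * (G i x).re : ℝ) : ℂ)) 2
      (volume.restrict D) := fun i => by
    refine (Lp.memLp (G i)).mono (Complex.continuous_ofReal.comp_aestronglyMeasurable
      ((hθc.comp_aestronglyMeasurable (hre u)).mul (hre (G i)))) (.of_forall fun x => ?_)
    rw [Complex.norm_real, Real.norm_eq_abs, abs_mul]
    exact (mul_le_of_le_one_left (abs_nonneg _) (hθ' _)).trans (Complex.abs_re_le_norm _)
  let K : Fin d → L2 D := fun i => (hKm i).toLp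
  have hK : ∀ i, K i =ᵐ[volume.restrict D] fun x => (deriv θ (u x).re * (G i x).re : ℝ) :=
    fun i => (hKm i).coeFn_toLp
  have hvu : ∀ᵐ x ∂(volume.restrict D), ‖v x‖ ≤ ‖u x‖ := by
    filter_upwards [hv] with x hx
    rw [hx, Complex.norm_real, Real.norm_eq_abs]
    exact (hθa _).trans (Complex.abs_re_le_norm _)
  have hvd : InFormDomain D V v K := by
    refine ⟨hG.comp_re hD hθ hθ' hv hK, hGi.mono
      (hVm.mul ((Lp.aestronglyMeasurable v).norm.pow 2)) ?_⟩
    filter_upwards [hvu] with x hx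
    rw [norm_mul, norm_mul, norm_pow, norm_pow, norm_norm, norm_norm]
    gcongr
  have hFi : Integrable (fun x => (V x : ℂ) * u x * (starRingEnd ℂ) (v x))
      (volume.restrict D) := by
    refine hGi.mono (((Complex.continuous_ofReal.comp_aestronglyMeasurable hVm).mul
      (Lp.aestronglyMeasurable u)).mul
      (Complex.continuous_conj.comp_aestronglyMeasurable (Lp.aestronglyMeasurable v))) ?_
    filter_upwards [hvu] with x hx
    rw [norm_mul, norm_mul, norm_mul, norm_pow, norm_norm, Complex.norm_real, RCLike.norm_conj,
      sq, mul_assoc]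
    gcongr
  have h1 : ∀ i, (inner ℂ (K i) (G i) : ℂ).re ≤ 0 := by
    intro i
    rw [L2.inner_def, ← RCLike.re_eq_complex_re, ← integral_re (L2.integrable_inner (K i) (G i))]
    refine integral_nonpos_of_ae ?_
    filter_upwards [hK i] with x hx
    rw [hx, RCLike.inner_apply, Complex.conj_ofReal, RCLike.re_eq_complex_re, Complex.re_mul_ofReal]
    have := mul_nonneg_of_nonpos_of_nonpos (hθn (u x).re) (neg_nonpos.2 (sq_nonneg (G i x).re))
    simp only [Pi.zero_apply]
    nlinarith
  have h2 : (∫ x in D, (V x : ℂ) * u x * (starRingEnd ℂ) (v x)).re ≤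
      c * (inner ℂ v u : ℂ).re := by
    rw [L2.inner_def, ← RCLike.re_eq_complex_re, ← integral_re hFi,
      ← integral_re (L2.integrable_inner v u), ← integral_const_mul]
    refine integral_mono_ae hFi.re ((L2.integrable_inner v u).re.const_mul c) ?_
    filter_upwards [hv, hc] with x hx hcx
    rw [hx, RCLike.inner_apply, Complex.conj_ofReal, RCLike.re_eq_complex_re,
      Complex.re_mul_ofReal, Complex.re_mul_ofReal, Complex.re_ofReal_mul,
      mul_assoc]
    exact mul_le_mul_of_nonpos_right hcx (hθm _)
  rw [H v K hvd, Complex.add_re]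
  have h3 : ((1 / 2 : ℂ) * ∑ i, inner ℂ (K i) (G i)).re ≤ 0 := by
    rw [show (1 / 2 : ℂ) = ((1 / 2 : ℝ) : ℂ) by norm_num, Complex.re_ofReal_mul, Complex.re_sum]
    exact mul_nonpos_of_nonneg_of_nonpos (by norm_num) (Finset.sum_nonpos fun i _ => h1 i)
  linarith

/-- The negative part of the real part. -/
noncomputable def negRe (z : ℂ) : ℂ := (max (-z.re) 0 : ℝ)

theorem lipschitzWith_negRe : LipschitzWith 1 negRe := by
  refine LipschitzWith.of_dist_le_mul fun z w => ?_
  rw [NNReal.coe_one, one_mul, dist_eq_norm, dist_eq_norm, negRe, negRe, ← Complex.ofReal_sub,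
    Complex.norm_real, Real.norm_eq_abs]
  refine (abs_max_sub_max_le_abs _ _ _).trans ?_
  rw [neg_sub_neg, abs_sub_comm, ← Complex.sub_re]
  exact Complex.abs_re_le_norm _

theorem negRe_zero : negRe 0 = 0 := by simp [negRe]

/-- The negative part of the real part, in `L²(D)`. -/
noncomputable def negL2 (u : L2 D) : L2 D := lipschitzWith_negRe.compLp negRe_zero u

theorem coeFn_negL2 (u : L2 D) : negL2 u =ᵐ[volume.restrict D] fun x => negRe (u x) :=
  lipschitzWith_negRe.coeFn_compLp negRe_zero u

theorem continuous_negL2 : Continuous (negL2 : L2 D → L2 D) :=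
  lipschitzWith_negRe.continuous_compLp negRe_zero

theorem re_inner_negL2_self (u : L2 D) : (inner ℂ (negL2 u) u : ℂ).re = -‖negL2 u‖ ^ 2 := by
  -- Pointwise, the negative part times the positive part of Re u is zero.
  have : (inner ℂ (negL2 u) (negL2 u + u) : ℂ).re = 0 := by
    rw [L2.inner_def, ← RCLike.re_eq_complex_re, ← integral_re (L2.integrable_inner _ _)]
    refine integral_eq_zero_of_ae ?_
    filter_upwards [coeFn_negL2 u, Lp.coeFn_add (negL2 u) u] with x hx hx'
    rw [hx', Pi.add_apply, hx, negRe, RCLike.inner_apply, Complex.conj_ofReal,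
      RCLike.re_eq_complex_re, Complex.re_mul_ofReal, Complex.add_re, Complex.ofReal_re]
    rcases le_total (-(u x).re) 0 with h | h <;> simp [h]
  rw [inner_add_right, Complex.add_re, inner_self_eq_norm_sq_to_K] at this
  have h' : (((‖negL2 u‖ : ℝ) : ℂ) ^ 2).re = ‖negL2 u‖ ^ 2 := by norm_cast
  simp only [Complex.coe_algebraMap] at this
  linarith

/-- The negative part is only Lipschitz, so the estimate is proved for `smoothNeg` and passes to the
limit ε → 0. -/
theorem SchrodingerGraph.re_inner_negL2_le (hD : IsOpen D) (hDf : volume D ≠ ∞)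
    (hVm : AEStronglyMeasurable V (volume.restrict D)) {c : ℝ}
    (hc : ∀ᵐ x ∂(volume.restrict D), c ≤ V x) {u h : L2 D} (hu : SchrodingerGraph D V u h) :
    (inner ℂ (negL2 u) h : ℂ).re ≤ -c * ‖negL2 u‖ ^ 2 := by
  have : IsFiniteMeasure (volume.restrict D) := ⟨by simpa using hDf.lt_top⟩
  have hlip : ∀ ε : ℝ, 0 < ε → LipschitzWith 1 (smoothNeg ε) := fun ε hε =>
    lipschitzWith_of_nnnorm_deriv_le ((contDiff_smoothNeg hε).differentiable one_ne_zero)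
      (fun s => by simpa [← NNReal.coe_le_coe] using abs_deriv_smoothNeg_le hε s)
  have habs : ∀ ε : ℝ, 0 < ε → ∀ s, |smoothNeg ε s| ≤ |s| := fun ε hε s => by
    simpa [smoothNeg_zero hε, Real.dist_eq] using (hlip ε hε).dist_le_mul s 0
  have hmem : ∀ ε : ℝ, 0 < ε → MemLp (fun x => (smoothNeg ε (u x).re : ℂ)) 2
      (volume.restrict D) := fun ε hε => by
    refine (Lp.memLp u).mono (Complex.continuous_ofReal.comp_aestronglyMeasurable
      ((contDiff_smoothNeg hε).continuous.comp_aestronglyMeasurable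
      (Complex.continuous_re.comp_aestronglyMeasurable (Lp.aestronglyMeasurable u))))
      (.of_forall fun x => ?_)
    rw [Complex.norm_real, Real.norm_eq_abs]
    exact (habs ε hε _).trans (Complex.abs_re_le_norm _)
  let ε : ℕ → ℝ := fun n => 1 / (n + 1)
  have hε : ∀ n, 0 < ε n := fun n => Nat.one_div_pos_of_nat
  let v : ℕ → L2 D := fun n => (hmem (ε n) (hε n)).toLp
  have hv : ∀ n, v n =ᵐ[volume.restrict D] fun x => (smoothNeg (ε n) (u x).re : ℂ) := fun n =>
    (hmem (ε n) (hε n)).coeFn_toLp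
  have hlim : Tendsto v atTop (𝓝 (negL2 u)) := by
    rw [tendsto_iff_norm_sub_tendsto_zero]
    have h0 := (tendsto_one_div_add_atTop_nhds_zero_nat (𝕜 := ℝ)).const_mul
      (measureUnivNNReal (volume.restrict D) ^ (2 : ℝ≥0∞).toReal⁻¹ : ℝ)
    rw [mul_zero] at h0
    refine squeeze_zero (fun _ => norm_nonneg _) (fun n => ?_) h0
    refine Lp.norm_le_of_ae_bound (hε n).le ?_
    filter_upwards [hv n, coeFn_negL2 u, Lp.coeFn_sub (v n) (negL2 u)] with x h1 h2 h3
    rw [h3, Pi.sub_apply, h1, h2, negRe, ← Complex.ofReal_sub, Complex.norm_real,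
      Real.norm_eq_abs]
    exact abs_smoothNeg_sub_le (hε n) _
  have hle : ∀ n, (inner ℂ (v n) h : ℂ).re ≤ c * (inner ℂ (v n) u : ℂ).re := fun n =>
    hu.re_inner_comp_le hD hVm hc (contDiff_smoothNeg (hε n)) (abs_deriv_smoothNeg_le (hε n))
      (deriv_smoothNeg_nonpos (hε n)) (mul_smoothNeg_nonpos (hε n)) (habs _ (hε n)) (hv n)
  have hli : ∀ k : L2 D, Tendsto (fun n => (inner ℂ (v n) k : ℂ).re) atTop
      (𝓝 (inner ℂ (negL2 u) k : ℂ).re) := fun k =>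
    (Complex.continuous_re.tendsto _).comp (hlim.inner tendsto_const_nhds)
  have := le_of_tendsto_of_tendsto' (hli h) ((hli u).const_mul c) hle
  rw [re_inner_negL2_self] at this
  linarith

/-- The function u + u⁻ has non-negative real part, and the distance from v(x) to any number with
non-negative real part is at least the negative part of Re v(x). -/
theorem norm_negL2_le (u v : L2 D) : ‖negL2 v‖ ≤ ‖(v - u) - negL2 u‖ := by
  refine Lp.norm_le_norm_of_ae_le ?_
  filter_upwards [coeFn_negL2 u, coeFn_negL2 v, Lp.coeFn_sub (v - u) (negL2 u),
    Lp.coeFn_sub v u] with x h1 h2 h3 h4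
  rw [h3, Pi.sub_apply, h4, Pi.sub_apply, h1, h2, negRe, negRe, Complex.norm_real]
  refine le_trans ?_ (Complex.abs_re_le_norm _)
  rw [Complex.sub_re, Complex.sub_re, Complex.ofReal_re, Real.norm_eq_abs,
    abs_of_nonneg (le_max_right _ _)]
  refine max_le ?_ (abs_nonneg _)
  have h5 := neg_abs_le ((v x).re - (u x).re - max (-(u x).re) 0)
  have h6 := le_max_left (-(u x).re) 0
  linarith

/-- A one-sided first-order expansion of the squared norm of the negative part. It bounds the upper
right derivative along a curve without differentiating that functional. -/
theorem norm_negL2_sq_le (u v : L2 D) :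
    ‖negL2 v‖ ^ 2 ≤ ‖negL2 u‖ ^ 2 - 2 * (inner ℂ (negL2 u) (v - u) : ℂ).re + ‖v - u‖ ^ 2 := by
  have h1 := pow_le_pow_left₀ (norm_nonneg _) (norm_negL2_le u v) 2
  have h2 := @norm_sub_sq ℂ _ _ _ _ (v - u) (negL2 u)
  have h3 := inner_re_symm (𝕜 := ℂ) (v - u) (negL2 u)
  simp only [RCLike.re_eq_complex_re] at h2 h3
  linarith

/-- The negative part of a solution of the evolution equation decays. -/
theorem negL2_eq_zero_of_solves (hD : IsOpen D) (hDf : volume D ≠ ∞)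
    (hVm : AEStronglyMeasurable V (volume.restrict D)) {c : ℝ}
    (hc : ∀ᵐ x ∂(volume.restrict D), c ≤ V x) {w : ℝ → L2 D} (hw : ContinuousOn w (Icc 0 T))
    (hw' : ∀ t ∈ Ioc 0 T, ∃ h : L2 D, SchrodingerGraph D V (w t) h ∧
      HasDerivWithinAt w (-h) (Icc 0 T) t) (h0 : negL2 (w 0) = 0) :
    ∀ t ∈ Icc 0 T, negL2 (w t) = 0 := by
  intro t ht
  rcases ht.1.eq_or_lt with rfl | ht0
  · exact h0
  let f : ℝ → ℝ := fun s => ‖negL2 (w s)‖ ^ 2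
  have hf : ContinuousOn f (Icc 0 T) := (continuous_negL2.comp_continuousOn hw).norm.pow 2
  -- Gronwall starts at ε > 0 because the equation holds only for positive times; ε → 0 is taken
  -- afterwards.
  have key : ∀ ε ∈ Ioo 0 t, f t ≤ f ε * Real.exp (-(2 * c) * (t - ε)) := by
    intro ε hε
    have hsub : Icc ε t ⊆ Icc 0 T := Icc_subset_Icc hε.1.le ht.2
    have := le_gronwallBound_of_liminf_deriv_right_le (f := f)
      (f' := fun s => -(2 * c) * f s) (δ := f ε) (K := -(2 * c)) (ε := 0) (hf.mono hsub) ?_ le_rfl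
      (fun s _ => by simp) t ⟨hε.2.le, le_rfl⟩
    · rwa [gronwallBound_ε0] at this
    · intro s hs r hr
      have hs' : s ∈ Ioo 0 T := ⟨hε.1.trans_le hs.1, hs.2.trans_le ht.2⟩
      obtain ⟨h, hh, hd⟩ := hw' s ⟨hs'.1, hs'.2.le⟩
      have hd1 := hd.hasDerivAt (Icc_mem_nhds hs'.1 hs'.2)
      have hsl : Tendsto (fun z => (z - s)⁻¹ • (w z - w s)) (𝓝[>] s) (𝓝 (-h)) :=
        (hasDerivAt_iff_tendsto_slope.1 hd1).mono_left
          (nhdsWithin_mono _ fun z hz => ne_of_gt hz)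
      have hz0 : Tendsto (fun z => z - s) (𝓝[>] s) (𝓝 0) := by
        have : Tendsto (fun z => z - s) (𝓝 s) (𝓝 (s - s)) := tendsto_id.sub_const s
        rw [sub_self] at this
        exact this.mono_left nhdsWithin_le_nhds
      -- The difference quotient of f is at most this expression. Since w' = -h, its limit is 2
      -- Re⟨w⁻, h⟩ ≤ -2c f(s).
      have hlim : Tendsto (fun z => -(2 * (inner ℂ (negL2 (w s))
          ((z - s)⁻¹ • (w z - w s)) : ℂ).re) + (z - s) * ‖(z - s)⁻¹ • (w z - w s)‖ ^ 2)
          (𝓝[>] s) (𝓝 (-(2 * (inner ℂ (negL2 (w s)) (-h) : ℂ).re) + 0 * ‖-h‖ ^ 2)) :=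
        ((((Complex.continuous_re.tendsto _).comp
          (tendsto_const_nhds.inner hsl)).const_mul 2).neg).add (hz0.mul (hsl.norm.pow 2))
      have hlt : -(2 * (inner ℂ (negL2 (w s)) (-h) : ℂ).re) + 0 * ‖-h‖ ^ 2 < r := by
        have h1 := hh.re_inner_negL2_le hD hDf hVm hc
        rw [inner_neg_right, Complex.neg_re]
        refine lt_of_le_of_lt ?_ hr
        simp only [f]
        linarith
      refine Eventually.frequently ?_
      filter_upwards [hlim.eventually (gt_mem_nhds hlt), self_mem_nhdsWithin] with z hz hzs
      have hzs' : 0 < z - s := sub_pos.2 hzs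
      refine lt_of_le_of_lt ?_ hz
      have h2 := norm_negL2_sq_le (w s) (w z)
      have h3 : (z - s)⁻¹ * (f z - f s) ≤ (z - s)⁻¹ *
          (-(2 * (inner ℂ (negL2 (w s)) (w z - w s) : ℂ).re) + ‖w z - w s‖ ^ 2) :=
        mul_le_mul_of_nonneg_left (by simp only [f]; linarith) (inv_nonneg.2 hzs'.le)
      refine h3.trans (le_of_eq ?_)
      rw [inner_smul_right_eq_smul, Complex.smul_re, smul_eq_mul, norm_smul, Real.norm_eq_abs,
        abs_of_nonneg (inv_nonneg.2 hzs'.le)]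
      field_simp
  have hlim : Tendsto (fun ε => f ε * Real.exp (-(2 * c) * (t - ε))) (𝓝[Ioo 0 t] 0)
      (𝓝 (f 0 * Real.exp (-(2 * c) * (t - 0)))) := by
    refine Tendsto.mul ((hf 0 ⟨le_rfl, ht.1.trans ht.2⟩).mono fun s hs =>
      ⟨hs.1.le, hs.2.le.trans ht.2⟩) ?_
    have : Continuous fun ε => Real.exp (-(2 * c) * (t - ε)) := by fun_prop
    exact (this.tendsto 0).mono_left nhdsWithin_le_nhds
  have : (𝓝[Ioo 0 t] (0 : ℝ)).NeBot := by
    rw [nhdsWithin_Ioo_eq_nhdsGT ht0]; infer_instance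
  have hle := ge_of_tendsto hlim (eventually_nhdsWithin_of_forall key)
  simp only [f, h0, norm_zero] at hle
  have : ‖negL2 (w t)‖ ^ 2 = 0 := le_antisymm (by simpa using hle) (sq_nonneg _)
  simpa using this

/-- The heat semigroup preserves positivity. -/
theorem IsHeatSemigroup.re_nonneg (hD : IsOpen D) (hDf : volume D ≠ ∞)
    (hVm : AEStronglyMeasurable V (volume.restrict D)) {c : ℝ}
    (hc : ∀ᵐ x ∂(volume.restrict D), c ≤ V x) {S : ℝ → L2 D →L[ℂ] L2 D}
    (hS : IsHeatSemigroup D V T g S) {f : L2 D}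
    (hf : ∀ᵐ x ∂(volume.restrict D), 0 ≤ (f x).re) {t : ℝ} (ht : t ∈ Icc 0 T) :
    ∀ᵐ x ∂(volume.restrict D), 0 ≤ (S t f x).re := by
  have h0 : negL2 (S 0 f) = 0 := by
    rw [hS.zero]
    refine Lp.ext ?_
    filter_upwards [hf, coeFn_negL2 f, Lp.coeFn_zero ℂ 2 (volume.restrict D)] with x h1 h2 h3
    rw [h2, h3, negRe, max_eq_right (by linarith), Complex.ofReal_zero, Pi.zero_apply]
  have h := negL2_eq_zero_of_solves hD hDf hVm hc (hS.continuousOn f) (hS.solves f) h0 t ht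
  have h' := coeFn_negL2 (S t f)
  rw [h] at h'
  filter_upwards [h', Lp.coeFn_zero ℂ 2 (volume.restrict D)] with x h1 h2
  rw [h2, Pi.zero_apply, negRe, eq_comm, Complex.ofReal_eq_zero, max_eq_right_iff] at h1
  linarith

/-! ### The heat flow on real functions -/

/-- The operators `f ↦ heatAct D g t f` are a symmetric positivity preserving semigroup on the
real `L²(D)`. -/
structure IsHeatFlow {d : ℕ} (D : Set (E d)) (T : ℝ) (g : E d → ℝ → E d → ℝ) : Prop where
  measurable : ∀ t ∈ Ioc 0 T, Measurable fun z : E d × E d => g z.1 t z.2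
  integrable : ∀ f, MemLp f 2 (volume.restrict D) → ∀ t ∈ Ioc 0 T,
    ∀ᵐ x ∂(volume.restrict D), Integrable (fun y => g x t y * f y) (volume.restrict D)
  memLp : ∀ f, MemLp f 2 (volume.restrict D) → ∀ t ∈ Icc 0 T,
    MemLp (heatAct D g t f) 2 (volume.restrict D)
  integral_mul : ∀ f h, MemLp f 2 (volume.restrict D) → MemLp h 2 (volume.restrict D) →
    ∀ s t, 0 ≤ s → 0 ≤ t → s + t ≤ T →
      ∫ x in D, heatAct D g s f x * heatAct D g t h x = ∫ x in D, f x * heatAct D g (s + t) h x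
  nonneg : ∀ f, MemLp f 2 (volume.restrict D) → (∀ᵐ x ∂(volume.restrict D), 0 ≤ f x) →
    ∀ t ∈ Icc 0 T, ∀ᵐ x ∂(volume.restrict D), 0 ≤ heatAct D g t f x

variable {d : ℕ} {D : Set (E d)} {V : E d → ℝ} {T : ℝ} {g : E d → ℝ → E d → ℝ}

/-- A real square integrable function as an element of the complex space `L²(D)`. -/
noncomputable def toL2 {f : E d → ℝ} (hf : MemLp f 2 (volume.restrict D)) : L2 D :=
  (hf.ofReal (K := ℂ)).toLp

theorem coeFn_toL2 {f : E d → ℝ} (hf : MemLp f 2 (volume.restrict D)) :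
    toL2 hf =ᵐ[volume.restrict D] fun x => (f x : ℂ) :=
  (hf.ofReal (K := ℂ)).coeFn_toLp

theorem inner_of_ae_eq {u v : L2 D} {f h : E d → ℝ}
    (hu : u =ᵐ[volume.restrict D] fun x => (f x : ℂ))
    (hv : v =ᵐ[volume.restrict D] fun x => (h x : ℂ)) :
    (inner ℂ u v : ℂ) = ((∫ x in D, f x * h x : ℝ) : ℂ) := by
  rw [L2.inner_def, ← integral_complex_ofReal]
  refine integral_congr_ae ?_
  filter_upwards [hu, hv] with x h1 h2
  rw [h1, h2, RCLike.inner_apply, Complex.conj_ofReal, mul_comm]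
  push_cast
  rfl

namespace IsHeatSemigroup

variable {S : ℝ → L2 D →L[ℂ] L2 D}

theorem apply_toL2 (hS : IsHeatSemigroup D V T g S) {f : E d → ℝ}
    (hf : MemLp f 2 (volume.restrict D)) {t : ℝ} (ht : t ∈ Icc 0 T) :
    S t (toL2 hf) =ᵐ[volume.restrict D] fun x => (heatAct D g t f x : ℂ) := by
  rcases ht.1.eq_or_lt with rfl | h0
  · rw [hS.zero]
    simpa [heatAct] using coeFn_toL2 hf
  · filter_upwards [hS.kernel (toL2 hf) t ⟨h0, ht.2⟩] with x hx
    rw [hx.2, heatAct, if_neg h0.ne', ← integral_complex_ofReal]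
    refine integral_congr_ae ?_
    filter_upwards [coeFn_toL2 hf] with y hy
    rw [hy]
    push_cast
    rfl

theorem isHeatFlow (hg : IsHeatKernel D V T g) (hD : IsOpen D) (hDf : volume D ≠ ∞)
    (hVm : AEStronglyMeasurable V (volume.restrict D)) {c : ℝ}
    (hc : ∀ᵐ x ∂(volume.restrict D), c ≤ V x) (hS : IsHeatSemigroup D V T g S) :
    IsHeatFlow D T g where
  measurable := hg.measurable
  integrable f hf t ht := by
    filter_upwards [hS.kernel (toL2 hf) t ht] with x hx
    refine hx.1.re.congr ?_
    filter_upwards [coeFn_toL2 hf] with y hy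
    rw [hy, ← Complex.ofReal_mul]
    rfl
  memLp f hf t ht := by
    refine (Lp.memLp (S t (toL2 hf))).re.ae_eq ?_
    filter_upwards [hS.apply_toL2 hf ht] with x hx
    rw [hx]
    rfl
  integral_mul f h hf hh s t hs ht hst := by
    have h1 := hS.inner_add (toL2 hf) (toL2 hh) s t hs ht hst
    have hst' : s + t ∈ Icc 0 T := ⟨by linarith, hst⟩
    rw [hS.inner_symm hst',
      inner_of_ae_eq (coeFn_toL2 hf) (hS.apply_toL2 hh hst'),
      inner_of_ae_eq (hS.apply_toL2 hf ⟨hs, by linarith⟩)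
        (hS.apply_toL2 hh ⟨ht, by linarith⟩)] at h1
    exact_mod_cast h1.symm
  nonneg f hf h0 t ht := by
    have := hS.re_nonneg hD hDf hVm hc (f := toL2 hf) (by
      filter_upwards [h0, coeFn_toL2 hf] with x h1 h2
      rw [h2]
      exact_mod_cast h1) ht
    filter_upwards [this, hS.apply_toL2 hf ht] with x h1 h2
    rw [h2] at h1
    exact_mod_cast h1

end IsHeatSemigroup

/-! ### Measure-theoretic lemmas -/

section Measure

/-- Only countably many test sets occur, so one null set of parameters serves for all of them when f
depends on a parameter. Finite unions of basic sets exhaust every open set, and outer regularity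
passes to measurable sets. -/
theorem ae_nonneg_of_setIntegral_sUnion_nonneg {X : Type*} [TopologicalSpace X]
    [SecondCountableTopology X] [TopologicalSpace.PseudoMetrizableSpace X] [MeasurableSpace X] [BorelSpace X]
    {μ : Measure X}
    {f : X → ℝ} (hf : Integrable f μ)
    (h : ∀ s : Set (Set X), s.Finite → s ⊆ TopologicalSpace.countableBasis X →
      0 ≤ ∫ x in ⋃₀ s, f x ∂μ) : 0 ≤ᵐ[μ] f := by
  have hopen : ∀ U : Set X, IsOpen U → 0 ≤ ∫ x in U, f x ∂μ := by
    intro U hU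
    obtain ⟨B, hB, rfl⟩ := (TopologicalSpace.isBasis_countableBasis X).open_eq_sUnion hU
    rcases B.eq_empty_or_nonempty with rfl | hne
    · simp
    obtain ⟨u, rfl⟩ := ((TopologicalSpace.countable_countableBasis X).mono hB).exists_eq_range hne
    let A : ℕ → Set X := fun n => ⋃₀ (u '' Iic n)
    have hA : Monotone A := fun m n hmn => sUnion_subset_sUnion (image_mono (Iic_subset_Iic.2 hmn))
    have hAU : ⋃ n, A n = ⋃₀ range u := by
      ext x
      simp only [A, mem_iUnion, mem_sUnion, mem_image, mem_range]
      constructor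
      · rintro ⟨n, s, ⟨i, -, rfl⟩, hx⟩
        exact ⟨_, ⟨i, rfl⟩, hx⟩
      · rintro ⟨s, ⟨i, rfl⟩, hx⟩
        exact ⟨i, _, ⟨i, mem_Iic.2 le_rfl, rfl⟩, hx⟩
    have hsub : ∀ n, u '' Iic n ⊆ TopologicalSpace.countableBasis X := fun n =>
      (image_subset_range _ _).trans hB
    have hm : ∀ n, MeasurableSet (A n) := fun n =>
      (isOpen_sUnion fun s hs => TopologicalSpace.isOpen_of_mem_countableBasis
        (hsub n hs)).measurableSet
    have := tendsto_setIntegral_of_monotone hm hA (μ := μ) hf.integrableOn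
    rw [hAU] at this
    exact ge_of_tendsto' this fun n => h _ ((finite_Iic n).image u) (hsub n)
  refine ae_nonneg_of_forall_setIntegral_nonneg hf fun A hA _ => ?_
  -- Outer regularity is applied to the finite measure |f| μ, so the integral of f over U \ A is
  -- controlled directly.
  have hν : IsFiniteMeasure (μ.withDensity fun x => ‖f x‖ₑ) := isFiniteMeasure_withDensity hf.2.ne
  refine le_of_forall_pos_le_add fun ε hε => ?_
  obtain ⟨U, hAU, hU, -, hd⟩ := hA.exists_isOpen_sdiff_lt
    (μ := μ.withDensity fun x => ‖f x‖ₑ) (measure_ne_top _ _) (ENNReal.ofReal_pos.2 hε).ne'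
  have h1 : ∫ x in U \ A, f x ∂μ ≤ ε := by
    refine (le_abs_self _).trans ?_
    rw [← Real.norm_eq_abs]
    refine (norm_integral_le_integral_norm _).trans ?_
    rw [integral_norm_eq_lintegral_enorm hf.1.restrict]
    rw [withDensity_apply _ (hU.measurableSet.diff hA)] at hd
    exact ENNReal.toReal_le_of_le_ofReal hε.le hd.le
  have h2 := hopen U hU
  rw [← inter_union_sdiff U A, inter_eq_right.2 hAU, setIntegral_union disjoint_sdiff_right
    (hU.measurableSet.diff hA) hf.integrableOn hf.integrableOn] at h2
  linarith

variable {X Y : Type*} [MeasurableSpace X] [MeasurableSpace Y] {μ : Measure X} {ν : Measure Y}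

/-- Rectangles form a π-system generating the product σ-algebra. The full rectangle gives total
integral zero, which handles complements. -/
theorem ae_eq_of_setIntegral_prod_eq {F G : X × Y → ℝ}
    (hF : Integrable F (μ.prod ν)) (hG : Integrable G (μ.prod ν))
    (h : ∀ A B, MeasurableSet A → MeasurableSet B →
      ∫ z in A ×ˢ B, F z ∂(μ.prod ν) = ∫ z in A ×ˢ B, G z ∂(μ.prod ν)) :
    F =ᵐ[μ.prod ν] G := by
  have hFG := hF.sub hG
  have key : ∀ s, MeasurableSet s → ∫ z in s, (F - G) z ∂(μ.prod ν) = 0 := by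
    have hrect : ∀ A B, MeasurableSet A → MeasurableSet B →
        ∫ z in A ×ˢ B, (F - G) z ∂(μ.prod ν) = 0 := fun A B hA hB => by
      simp only [Pi.sub_apply]
      rw [integral_sub hF.integrableOn hG.integrableOn, h A B hA hB, sub_self]
    intro s hs
    induction s, hs using MeasurableSpace.induction_on_inter generateFrom_prod.symm
      isPiSystem_prod with
    | empty => simp
    | basic t ht =>
      obtain ⟨A, hA, B, hB, rfl⟩ := ht
      exact hrect A B hA hB
    | compl t ht ih =>
      have h1 := integral_add_compl ht hFG
      have h2 := hrect univ univ .univ .univ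
      rw [univ_prod_univ, Measure.restrict_univ] at h2
      linarith
    | iUnion f hd hm ih =>
      rw [integral_iUnion hm hd hFG.integrableOn]
      simp only [ih, tsum_zero]
  have := hFG.ae_eq_zero_of_forall_setIntegral_eq_zero fun s hs _ => key s hs
  filter_upwards [this] with z hz
  simpa [sub_eq_zero] using hz

/-- A finite measure given by a signed density. -/
theorem eq_withDensity_of_measureReal_eq {P : Measure X} [IsFiniteMeasure P] {ρ : X → ℝ}
    (hρ : Integrable ρ μ) (h : ∀ A, MeasurableSet A → P.real A = ∫ x in A, ρ x ∂μ) :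
    0 ≤ᵐ[μ] ρ ∧ P = μ.withDensity fun x => ENNReal.ofReal (ρ x) := by
  have h0 : 0 ≤ᵐ[μ] ρ := ae_nonneg_of_forall_setIntegral_nonneg hρ fun s hs _ => by
    rw [← h s hs]; exact measureReal_nonneg
  refine ⟨h0, Measure.ext fun A hA => ?_⟩
  rw [withDensity_apply _ hA, ← ofReal_integral_eq_lintegral_ofReal hρ.integrableOn
    (ae_restrict_of_ae h0), ← h A hA, ofReal_measureReal]

/-- No integrability of f is asked: the transition function, a quotient by the kernel, has no a
priori bound. -/
theorem integral_eq_of_measureReal_eq {P : Measure X} [IsFiniteMeasure P] {ρ : X → ℝ}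
    (hρ : Integrable ρ μ) (h : ∀ A, MeasurableSet A → P.real A = ∫ x in A, ρ x ∂μ) (f : X → ℝ) :
    ∫ x, f x ∂P = ∫ x, ρ x * f x ∂μ := by
  obtain ⟨h0, rfl⟩ := eq_withDensity_of_measureReal_eq hρ h
  rw [integral_withDensity_eq_integral_toReal_smul₀ hρ.1.aemeasurable.ennreal_ofReal
    (.of_forall fun _ => ENNReal.ofReal_lt_top)]
  refine integral_congr_ae ?_
  filter_upwards [h0] with x hx
  rw [ENNReal.toReal_ofReal hx, smul_eq_mul]

end Measure

/-! ### The heat kernel -/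

variable {d : ℕ} {D : Set (E d)} {T : ℝ} {g : E d → ℝ → E d → ℝ}

/-- The unnormalized mass that the bridge from `q.1` to `q.2` gives to the set `F`. -/
noncomputable def bridge (D : Set (E d)) (g : E d → ℝ → E d → ℝ) (s t : ℝ) (F : Set (E d))
    (q : E d × E d) : ℝ :=
  ∫ z in F ∩ D, g z s q.1 * g z t q.2

theorem heatAct_zero (f : E d → ℝ) : heatAct D g 0 f = f := by
  funext x
  simp [heatAct]

theorem heatAct_of_pos {t : ℝ} (ht : 0 < t) (f : E d → ℝ) (x : E d) :
    heatAct D g t f x = ∫ y in D, g x t y * f y := by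
  rw [heatAct, if_neg ht.ne']

namespace IsHeatFlow

variable {φ ψ : E d → ℝ}

theorem integral_mul_symm (hG : IsHeatFlow D T g) (hφ : MemLp φ 2 (volume.restrict D))
    (hψ : MemLp ψ 2 (volume.restrict D)) {t : ℝ} (ht : t ∈ Icc 0 T) :
    ∫ x in D, heatAct D g t φ x * ψ x = ∫ x in D, φ x * heatAct D g t ψ x := by
  have := hG.integral_mul φ ψ hφ hψ t 0 ht.1 le_rfl (by simpa using ht.2)
  rwa [heatAct_zero, add_zero] at this

theorem bridge_eq {F : Set (E d)} (hF : MeasurableSet F) (s t : ℝ) (q : E d × E d) :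
    bridge D g s t F q = ∫ z in F, g z s q.1 * g z t q.2 ∂(volume.restrict D) := by
  rw [bridge, Measure.restrict_restrict hF]

variable [IsFiniteMeasure (volume.restrict D)]

theorem memLp_indicator_one {A : Set (E d)} (hA : MeasurableSet A) :
    MemLp (A.indicator fun _ => (1 : ℝ)) 2 (volume.restrict D) :=
  (memLp_const 1).indicator hA

theorem kernel_integrable (hG : IsHeatFlow D T g) {t : ℝ} (ht : t ∈ Ioc 0 T) :
    ∀ᵐ x ∂(volume.restrict D), Integrable (g x t) (volume.restrict D) := by
  simpa using hG.integrable (fun _ => 1) (memLp_const 1) t ht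

/-- Positivity of the operators on indicators holds for almost every x with a null set depending on
the indicator. Restricting to finite unions from a countable basis makes that null set common. -/
theorem kernel_nonneg (hG : IsHeatFlow D T g) {t : ℝ} (ht : t ∈ Ioc 0 T) :
    ∀ᵐ x ∂(volume.restrict D), ∀ᵐ y ∂(volume.restrict D), 0 ≤ g x t y := by
  have hc : {s : Set (Set (E d)) |
      s.Finite ∧ s ⊆ TopologicalSpace.countableBasis (E d)}.Countable :=
    Set.countable_ofPred_finite_subset (TopologicalSpace.countable_countableBasis _)
  have h1 : ∀ᵐ x ∂(volume.restrict D), ∀ s ∈ {s : Set (Set (E d)) |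
      s.Finite ∧ s ⊆ TopologicalSpace.countableBasis (E d)},
        0 ≤ ∫ y in ⋃₀ s, g x t y ∂(volume.restrict D) := by
    refine (ae_ball_iff hc).2 fun s hs => ?_
    have hm : MeasurableSet (⋃₀ s) := (isOpen_sUnion fun u hu =>
      TopologicalSpace.isOpen_of_mem_countableBasis (hs.2 hu)).measurableSet
    filter_upwards [hG.nonneg _ (memLp_indicator_one hm)
      (.of_forall fun x => indicator_nonneg (fun _ _ => zero_le_one) x) t
      (Ioc_subset_Icc_self ht)] with x hx
    rw [heatAct_of_pos ht.1] at hx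
    rw [← integral_indicator hm]
    refine hx.trans_eq (integral_congr_ae (.of_forall fun y => ?_))
    by_cases hy : y ∈ ⋃₀ s
    · simp only [indicator_of_mem hy, mul_one]
    · simp only [indicator_of_notMem hy, mul_zero]
  filter_upwards [h1, hG.kernel_integrable ht] with x hx hi
  exact ae_nonneg_of_setIntegral_sUnion_nonneg hi fun s h1 h2 => hx s ⟨h1, h2⟩

/-- The kernel tested against two square integrable functions. -/
theorem integrable_mul_kernel_mul (hG : IsHeatFlow D T g) {t : ℝ} (ht : t ∈ Ioc 0 T)
    (hφ : MemLp φ 2 (volume.restrict D)) (hψ : MemLp ψ 2 (volume.restrict D)) :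
    Integrable (fun z : E d × E d => φ z.1 * (g z.1 t z.2 * ψ z.2))
      ((volume.restrict D).prod (volume.restrict D)) := by
  refine (integrable_prod_iff ?_).2 ⟨?_, ?_⟩
  · exact hφ.1.comp_fst.mul ((hG.measurable t ht).aestronglyMeasurable.mul hψ.1.comp_snd)
  · filter_upwards [hG.integrable ψ hψ t ht] with x hx
    exact hx.const_mul _
  · have hi : Integrable (fun x => |φ x| * heatAct D g t (fun y => |ψ y|) x)
        (volume.restrict D) :=
      hφ.abs.integrable_mul (hG.memLp _ hψ.abs t (Ioc_subset_Icc_self ht))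
    refine hi.congr ?_
    filter_upwards [hG.kernel_nonneg ht] with x hx
    rw [heatAct_of_pos ht.1, ← integral_const_mul]
    refine integral_congr_ae ?_
    filter_upwards [hx] with y hy
    rw [norm_mul, norm_mul, Real.norm_eq_abs, Real.norm_eq_abs, Real.norm_eq_abs, abs_of_nonneg hy]

theorem integral_mul_kernel_mul (hG : IsHeatFlow D T g) {t : ℝ} (ht : t ∈ Ioc 0 T)
    (hφ : MemLp φ 2 (volume.restrict D)) (hψ : MemLp ψ 2 (volume.restrict D)) :
    ∫ z, φ z.1 * (g z.1 t z.2 * ψ z.2) ∂((volume.restrict D).prod (volume.restrict D)) =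
      ∫ x in D, φ x * heatAct D g t ψ x := by
  rw [integral_prod _ (hG.integrable_mul_kernel_mul ht hφ hψ)]
  simp only [integral_const_mul, heatAct_of_pos ht.1]

theorem integrable_kernel_prod (hG : IsHeatFlow D T g) {t : ℝ} (ht : t ∈ Ioc 0 T) :
    Integrable (fun z : E d × E d => g z.1 t z.2)
      ((volume.restrict D).prod (volume.restrict D)) := by
  simpa using hG.integrable_mul_kernel_mul (φ := fun _ => 1) (ψ := fun _ => 1) ht
    (memLp_const 1) (memLp_const 1)

theorem setIntegral_prod_kernel (hG : IsHeatFlow D T g) {t : ℝ} (ht : t ∈ Ioc 0 T)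
    {A B : Set (E d)} (hA : MeasurableSet A) (hB : MeasurableSet B) :
    ∫ z in A ×ˢ B, g z.1 t z.2 ∂((volume.restrict D).prod (volume.restrict D)) =
      ∫ x in D, A.indicator (fun _ => 1) x * heatAct D g t (B.indicator fun _ => 1) x := by
  rw [← hG.integral_mul_kernel_mul ht (memLp_indicator_one hA) (memLp_indicator_one hB),
    ← integral_indicator (hA.prod hB)]
  refine integral_congr_ae (.of_forall fun z => ?_)
  by_cases h1 : z.1 ∈ A <;> by_cases h2 : z.2 ∈ B <;> simp [indicator, h1, h2]

theorem kernel_symm (hG : IsHeatFlow D T g) {t : ℝ} (ht : t ∈ Ioc 0 T) :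
    ∀ᵐ z ∂((volume.restrict D).prod (volume.restrict D)), g z.1 t z.2 = g z.2 t z.1 := by
  refine ae_eq_of_setIntegral_prod_eq (hG.integrable_kernel_prod ht)
    (G := fun z => g z.2 t z.1) (hG.integrable_kernel_prod ht).swap fun A B hA hB => ?_
  have hsw : ∫ z in A ×ˢ B, g z.2 t z.1 ∂((volume.restrict D).prod (volume.restrict D)) =
      ∫ z in B ×ˢ A, g z.1 t z.2 ∂((volume.restrict D).prod (volume.restrict D)) :=
    setIntegral_prod_swap B A fun z : E d × E d => g z.1 t z.2
  rw [hsw, hG.setIntegral_prod_kernel ht hA hB, hG.setIntegral_prod_kernel ht hB hA,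
    ← hG.integral_mul_symm (memLp_indicator_one hA) (memLp_indicator_one hB)
      (Ioc_subset_Icc_self ht)]
  simp only [mul_comm]

/-- The two kernels issuing from a common point tested against square integrable functions. -/
theorem integrable_kernel_mul_kernel (hG : IsHeatFlow D T g) {s t : ℝ} (hs : s ∈ Ioc 0 T)
    (ht : t ∈ Ioc 0 T) (hφ : MemLp φ 2 (volume.restrict D)) (hψ : MemLp ψ 2 (volume.restrict D)) :
    Integrable (fun w : E d × E d × E d => (g w.1 s w.2.1 * φ w.2.1) * (g w.1 t w.2.2 * ψ w.2.2))
      ((volume.restrict D).prod ((volume.restrict D).prod (volume.restrict D))) := by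
  refine (integrable_prod_iff ?_).2 ⟨?_, ?_⟩
  · have h1 : Measurable fun w : E d × E d × E d => g w.1 s w.2.1 :=
      (hG.measurable s hs).comp (measurable_fst.prodMk (measurable_fst.comp measurable_snd))
    have h2 : Measurable fun w : E d × E d × E d => g w.1 t w.2.2 :=
      (hG.measurable t ht).comp (measurable_fst.prodMk (measurable_snd.comp measurable_snd))
    exact (h1.aestronglyMeasurable.mul hφ.1.comp_fst.comp_snd).mul
      (h2.aestronglyMeasurable.mul hψ.1.comp_snd.comp_snd)
  · filter_upwards [hG.integrable φ hφ s hs, hG.integrable ψ hψ t ht] with z h1 h2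
    exact h1.mul_prod h2
  · have hi : Integrable (fun z => heatAct D g s (fun y => |φ y|) z *
        heatAct D g t (fun y => |ψ y|) z) (volume.restrict D) :=
      (hG.memLp _ hφ.abs s (Ioc_subset_Icc_self hs)).integrable_mul
        (hG.memLp _ hψ.abs t (Ioc_subset_Icc_self ht))
    refine hi.congr ?_
    filter_upwards [hG.kernel_nonneg hs, hG.kernel_nonneg ht] with z h1 h2
    simp only [norm_mul _ (_ * _)]
    rw [integral_prod_mul (fun x => ‖g z s x * φ x‖) (fun y => ‖g z t y * ψ y‖),
      heatAct_of_pos hs.1, heatAct_of_pos ht.1]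
    congr 1
    · refine integral_congr_ae ?_
      filter_upwards [h1] with y hy
      rw [norm_mul, Real.norm_eq_abs, Real.norm_eq_abs, abs_of_nonneg hy]
    · refine integral_congr_ae ?_
      filter_upwards [h2] with y hy
      rw [norm_mul, Real.norm_eq_abs, Real.norm_eq_abs, abs_of_nonneg hy]

/-- In `bridge` both kernels issue from the intermediate point z. For fixed z the integral over the
endpoints is thus a product of two heat flows, and Fubini does the rest. -/
theorem integrable_mul_bridge_and_integral (hG : IsHeatFlow D T g) {s t : ℝ} (hs : s ∈ Ioc 0 T)
    (ht : t ∈ Ioc 0 T) (hφ : MemLp φ 2 (volume.restrict D)) (hψ : MemLp ψ 2 (volume.restrict D))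
    {F : Set (E d)} (hF : MeasurableSet F) :
    Integrable (fun q : E d × E d => φ q.1 * ψ q.2 * bridge D g s t F q)
        ((volume.restrict D).prod (volume.restrict D)) ∧
      ∫ q, φ q.1 * ψ q.2 * bridge D g s t F q ∂((volume.restrict D).prod (volume.restrict D)) =
        ∫ z in F, heatAct D g s φ z * heatAct D g t ψ z ∂(volume.restrict D) := by
  have hi : Integrable
      (fun w : E d × E d × E d => (g w.1 s w.2.1 * φ w.2.1) * (g w.1 t w.2.2 * ψ w.2.2))
      (((volume.restrict D).restrict F).prod ((volume.restrict D).prod (volume.restrict D))) :=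
    (hG.integrable_kernel_mul_kernel hs ht hφ hψ).mono_measure
      (Measure.prod_mono Measure.restrict_le_self le_rfl)
  have he : (fun q : E d × E d => φ q.1 * ψ q.2 * bridge D g s t F q) = fun q =>
      ∫ z in F, (g z s q.1 * φ q.1) * (g z t q.2 * ψ q.2) ∂(volume.restrict D) := by
    funext q
    rw [bridge_eq hF, ← integral_const_mul]
    congr 1
    funext z
    ring
  rw [he]
  refine ⟨hi.integral_prod_right, ?_⟩
  have := integral_integral_swap (f := fun z (q : E d × E d) =>
    (g z s q.1 * φ q.1) * (g z t q.2 * ψ q.2)) hi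
  rw [← this]
  refine integral_congr_ae (.of_forall fun z => ?_)
  simp only [heatAct_of_pos hs.1, heatAct_of_pos ht.1]
  exact integral_prod_mul (fun x => g z s x * φ x) fun y => g z t y * ψ y

theorem integrable_bridge (hG : IsHeatFlow D T g) {s t : ℝ} (hs : s ∈ Ioc 0 T)
    (ht : t ∈ Ioc 0 T) {F : Set (E d)} (hF : MeasurableSet F) :
    Integrable (bridge D g s t F) ((volume.restrict D).prod (volume.restrict D)) := by
  simpa using (hG.integrable_mul_bridge_and_integral (φ := fun _ => 1) (ψ := fun _ => 1) hs ht
    (memLp_const 1) (memLp_const 1) hF).1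

/-- The Chapman-Kolmogorov equation. -/
theorem bridge_univ (hG : IsHeatFlow D T g) {s t : ℝ} (hs : 0 < s) (ht : 0 < t)
    (hst : s + t ≤ T) : ∀ᵐ q ∂((volume.restrict D).prod (volume.restrict D)),
      bridge D g s t univ q = g q.1 (s + t) q.2 := by
  have hs' : s ∈ Ioc 0 T := ⟨hs, by linarith⟩
  have ht' : t ∈ Ioc 0 T := ⟨ht, by linarith⟩
  have hst' : s + t ∈ Ioc 0 T := ⟨by linarith, hst⟩
  refine ae_eq_of_setIntegral_prod_eq (hG.integrable_bridge hs' ht' .univ)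
    (hG.integrable_kernel_prod hst') fun A B hA hB => ?_
  rw [hG.setIntegral_prod_kernel hst' hA hB, ← hG.integral_mul _ _ (memLp_indicator_one hA)
    (memLp_indicator_one hB) s t hs.le ht.le hst]
  have := (hG.integrable_mul_bridge_and_integral hs' ht' (memLp_indicator_one hA)
    (memLp_indicator_one hB) .univ).2
  rw [Measure.restrict_univ] at this
  rw [← this, ← integral_indicator (hA.prod hB)]
  refine integral_congr_ae (.of_forall fun z => ?_)
  by_cases h1 : z.1 ∈ A <;> by_cases h2 : z.2 ∈ B <;> simp [indicator, h1, h2]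

theorem kernel_mul_kernel_nonneg (hG : IsHeatFlow D T g) {s t : ℝ} (hs : s ∈ Ioc 0 T)
    (ht : t ∈ Ioc 0 T) : ∀ᵐ q ∂((volume.restrict D).prod (volume.restrict D)),
      (∀ᵐ z ∂(volume.restrict D), 0 ≤ g z s q.1 * g z t q.2) ∧
        Integrable (fun z => g z s q.1 * g z t q.2) (volume.restrict D) := by
  have hi := hG.integrable_kernel_mul_kernel (φ := fun _ => 1) (ψ := fun _ => 1) hs ht
    (memLp_const 1) (memLp_const 1)
  simp only [mul_one] at hi
  have h1 : ∀ᵐ z ∂(volume.restrict D), ∀ᵐ q ∂((volume.restrict D).prod (volume.restrict D)),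
      0 ≤ g z s q.1 * g z t q.2 := by
    filter_upwards [hG.kernel_nonneg hs, hG.kernel_nonneg ht] with z h1 h2
    filter_upwards [Measure.quasiMeasurePreserving_fst.ae h1,
      Measure.quasiMeasurePreserving_snd.ae h2] with q h3 h4
    exact mul_nonneg h3 h4
  have hm1 : Measurable fun w : E d × E d × E d => g w.1 s w.2.1 :=
    (hG.measurable s hs).comp (measurable_fst.prodMk (measurable_fst.comp measurable_snd))
  have hm2 : Measurable fun w : E d × E d × E d => g w.1 t w.2.2 :=
    (hG.measurable t ht).comp (measurable_fst.prodMk (measurable_snd.comp measurable_snd))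
  have hm : MeasurableSet {w : E d × E d × E d | 0 ≤ g w.1 s w.2.1 * g w.1 t w.2.2} :=
    measurableSet_le measurable_const (hm1.mul hm2)
  -- Joint measurability exchanges "for almost every z, almost every q" with the opposite order.
  filter_upwards [(Measure.ae_ae_comm hm).1 h1, hi.prod_left_ae] with q h2 h3
  exact ⟨h2, h3⟩

/-- The transition function is the bridge mass divided by the total mass; no strict positivity
of the kernel is needed because the bridge mass vanishes where the total mass does. -/
theorem kernel_mul_transition (hG : IsHeatFlow D T g) {t : ℝ} (ht : t ∈ Ioo 0 T)
    {F : Set (E d)} (hF : MeasurableSet F) :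
    ∀ᵐ q ∂((volume.restrict D).prod (volume.restrict D)),
      g q.1 T q.2 * transition D g q.2 T F t q.1 0 = bridge D g t (T - t) F q := by
  have h1 : t ∈ Ioc 0 T := ⟨ht.1, ht.2.le⟩
  have h2 : T - t ∈ Ioc 0 T := ⟨by linarith [ht.2], by linarith [ht.1]⟩
  have h3 : T ∈ Ioc 0 T := ⟨ht.1.trans ht.2, le_rfl⟩
  have hCK := hG.bridge_univ ht.1 h2.1 (by linarith)
  have hsymm : ∀ᵐ q ∂((volume.restrict D).prod (volume.restrict D)),
      ∀ᵐ z ∂(volume.restrict D), g q.2 (T - t) z = g z (T - t) q.2 :=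
    Measure.quasiMeasurePreserving_snd.ae (Measure.ae_ae_of_ae_prod (hG.kernel_symm h2))
  rw [add_sub_cancel] at hCK
  filter_upwards [hCK, hG.kernel_symm h3, hsymm, hG.kernel_mul_kernel_nonneg h1 h2]
    with q hq1 hq2 hq3 hq4
  have htr : transition D g q.2 T F t q.1 0 = bridge D g t (T - t) F q / g q.1 T q.2 := by
    rw [transition, bridge, sub_zero, sub_zero, ← hq2, ← Measure.restrict_restrict hF,
      ← integral_div]
    refine integral_congr_ae (ae_restrict_of_ae ?_)
    filter_upwards [hq3] with z hz
    rw [hz, mul_comm (g z t q.1)]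
  rw [htr]
  -- Where the kernel vanishes, the bridge mass of F lies between 0 and the total mass, which is the
  -- kernel itself by Chapman-Kolmogorov.
  by_cases h0 : g q.1 T q.2 = 0
  · rw [h0, zero_mul]
    refine le_antisymm ?_ ?_
    · rw [bridge_eq hF]
      exact setIntegral_nonneg_of_ae hq4.1
    · rw [← h0, ← hq1, bridge_eq hF, bridge_eq .univ, Measure.restrict_univ]
      exact setIntegral_le_integral hq4.2 hq4.1
  · exact mul_div_cancel₀ _ h0

end IsHeatFlow

/-! ### Series of integrable functions -/

theorem integrable_tsum_of_summable_integral_norm {X ι : Type*} [MeasurableSpace X]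
    {μ : Measure X} [Countable ι] {F : ι → X → ℝ} (hF : ∀ i, Integrable (F i) μ)
    (hs : Summable fun i => ∫ x, ‖F i x‖ ∂μ) : Integrable (fun x => ∑' i, F i x) μ := by
  have hfin : ∫⁻ x, ∑' i, ‖F i x‖ₑ ∂μ ≠ ∞ := by
    rw [lintegral_tsum fun i => (hF i).1.enorm]
    simp_rw [← fun i => ofReal_integral_norm_eq_lintegral_enorm (hF i)]
    exact hs.tsum_ofReal_ne_top
  have hae : ∀ᵐ x ∂μ, Summable fun i => F i x := by
    filter_upwards [ae_lt_top' (AEMeasurable.tsum fun i => (hF i).1.enorm) hfin] with x hx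
    exact Summable.of_enorm hx.ne
  refine ⟨?_, ?_⟩
  · refine aestronglyMeasurable_of_tendsto_ae (atTop : Filter (Finset ι))
      (f := fun s x => ∑ i ∈ s, F i x) (fun s => ?_) ?_
    · exact Finset.aestronglyMeasurable_fun_sum s fun i _ => (hF i).1
    · filter_upwards [hae] with x hx using hx.hasSum
  · refine lt_of_le_of_lt (lintegral_mono fun x => ?_) hfin.lt_top
    exact enorm_tsum_le_tsum_enorm

/-! ### The law of the mixed Bernstein process -/

section Mixture

variable {d : ℕ} {D : Set (E d)} {T : ℝ} {g : E d → ℝ → E d → ℝ} {p a c : (Fin d → ℕ) → ℝ}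
  {φ ψ : (Fin d → ℕ) → E d → ℝ}

/-- The mixture of the products of the data functions. -/
noncomputable def mixture (p : (Fin d → ℕ) → ℝ) (φ ψ : (Fin d → ℕ) → E d → ℝ) (q : E d × E d) :
    ℝ :=
  ∑' m, p m * (φ m q.1 * ψ m q.2)

/-- The m-th term is dominated by pₘ aₘ cₘ |K|, so sum and integral can be exchanged. K will be the
kernel at time T, its restriction to a set, or a bridge mass. -/
theorem integrable_mixture_mul_and_hasSum [IsFiniteMeasure (volume.restrict D)] (hp0 : ∀ m, 0 ≤ p m)
    (hφ : ∀ m, AEStronglyMeasurable (φ m) (volume.restrict D))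
    (hψ : ∀ m, AEStronglyMeasurable (ψ m) (volume.restrict D))
    (hφb : ∀ m, ∀ᵐ x ∂(volume.restrict D), |φ m x| ≤ a m)
    (hψb : ∀ m, ∀ᵐ x ∂(volume.restrict D), |ψ m x| ≤ c m)
    (hac : Summable fun m => p m * a m * c m) {K : E d × E d → ℝ}
    (hK : Integrable K ((volume.restrict D).prod (volume.restrict D))) :
    Integrable (fun q => mixture p φ ψ q * K q) ((volume.restrict D).prod (volume.restrict D)) ∧
      HasSum (fun m => p m *
          ∫ q, φ m q.1 * ψ m q.2 * K q ∂((volume.restrict D).prod (volume.restrict D)))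
        (∫ q, mixture p φ ψ q * K q ∂((volume.restrict D).prod (volume.restrict D))) := by
  let F : (Fin d → ℕ) → E d × E d → ℝ := fun m q => p m * (φ m q.1 * ψ m q.2) * K q
  have hb : ∀ m, ∀ᵐ q ∂((volume.restrict D).prod (volume.restrict D)),
      ‖F m q‖ ≤ p m * a m * c m * ‖K q‖ := by
    intro m
    filter_upwards [Measure.quasiMeasurePreserving_fst.ae (hφb m),
      Measure.quasiMeasurePreserving_snd.ae (hψb m)] with q h1 h2
    simp only [F, norm_mul, Real.norm_eq_abs, abs_of_nonneg (hp0 m), mul_assoc (p m)]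
    have := hp0 m
    have : 0 ≤ a m := (abs_nonneg _).trans h1
    gcongr
  have hF : ∀ m, Integrable (F m) ((volume.restrict D).prod (volume.restrict D)) := fun m =>
    (hK.norm.const_mul (p m * a m * c m)).mono'
      ((((hφ m).comp_fst.mul (hψ m).comp_snd).const_mul (p m)).mul hK.1) (hb m)
  have hs : Summable fun m => ∫ q, ‖F m q‖ ∂((volume.restrict D).prod (volume.restrict D)) := by
    refine Summable.of_nonneg_of_le (fun m => integral_nonneg fun _ => norm_nonneg _) (fun m => ?_)
      (hac.mul_right (∫ q, ‖K q‖ ∂((volume.restrict D).prod (volume.restrict D))))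
    rw [← integral_const_mul]
    exact integral_mono_ae (hF m).norm (hK.norm.const_mul _) (hb m)
  have he : ∀ q, mixture p φ ψ q * K q = ∑' m, F m q := fun q => tsum_mul_right.symm
  simp_rw [he]
  refine ⟨integrable_tsum_of_summable_integral_norm hF hs, ?_⟩
  refine HasSum.congr_fun (hasSum_integral_of_summable_integral_norm hF hs) fun m => ?_
  rw [← integral_const_mul]
  refine integral_congr_ae (.of_forall fun q => ?_)
  simp only [F]
  ring

theorem measurable_transition (hG : IsHeatFlow D T g) {t : ℝ} (ht : t ∈ Ioo 0 T) (F : Set (E d)) :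
    Measurable fun q : E d × E d => transition D g q.2 T F t q.1 0 := by
  have h1 : t - 0 ∈ Ioc 0 T := ⟨by linarith [ht.1], by linarith [ht.2]⟩
  have h2 : T - t ∈ Ioc 0 T := ⟨by linarith [ht.2], by linarith [ht.1]⟩
  have h3 : T - 0 ∈ Ioc 0 T := ⟨by linarith [ht.1, ht.2], by linarith⟩
  have m1 : Measurable fun w : (E d × E d) × E d => g w.1.2 (T - t) w.2 :=
    (hG.measurable _ h2).comp ((measurable_snd.comp measurable_fst).prodMk measurable_snd)
  have m2 : Measurable fun w : (E d × E d) × E d => g w.2 (t - 0) w.1.1 :=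
    (hG.measurable _ h1).comp (measurable_snd.prodMk (measurable_fst.comp measurable_fst))
  have m3 : Measurable fun w : (E d × E d) × E d => g w.1.2 (T - 0) w.1.1 :=
    (hG.measurable _ h3).comp
      ((measurable_snd.comp measurable_fst).prodMk (measurable_fst.comp measurable_fst))
  exact (((m1.mul m2).div m3).stronglyMeasurable.integral_prod_right').measurable

variable {Ω : Type*} [MeasurableSpace Ω] {P : Measure Ω} {Z : ℝ → Ω → E d}

theorem endpointMeasure_eq {f h : E d → ℝ} {G : Set (E d × E d)} (hGm : MeasurableSet G) :
    endpointMeasure D g T f h G = ∫ q, f q.1 * h q.2 * G.indicator (fun q => g q.1 T q.2) q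
      ∂((volume.restrict D).prod (volume.restrict D)) := by
  rw [endpointMeasure, ← Measure.restrict_restrict hGm, Measure.volume_eq_prod,
    ← Measure.prod_restrict, ← integral_indicator hGm]
  refine integral_congr_ae (.of_forall fun q => ?_)
  by_cases hq : q ∈ G
  · simp only [indicator_of_mem hq]
    ring
  · simp only [indicator_of_notMem hq, mul_zero]

namespace IsMixedProcess

theorem measurable_endpoints (hT : 0 < T) (hZ : IsMixedProcess D T g p φ ψ P Z) :
    Measurable fun ω => (Z 0 ω, Z T ω) :=
  (hZ.isBernstein.measurable 0 ⟨le_rfl, hT.le⟩).prodMk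
    (hZ.isBernstein.measurable T ⟨hT.le, le_rfl⟩)

variable [IsFiniteMeasure (volume.restrict D)] [IsProbabilityMeasure P]

/-- At an intermediate time the law of the process is the mixture of the bridges. -/
theorem measureReal_preimage (hG : IsHeatFlow D T g) (hp0 : ∀ m, 0 ≤ p m)
    (hφ : ∀ m, AEStronglyMeasurable (φ m) (volume.restrict D))
    (hψ : ∀ m, AEStronglyMeasurable (ψ m) (volume.restrict D))
    (hφb : ∀ m, ∀ᵐ x ∂(volume.restrict D), |φ m x| ≤ a m)
    (hψb : ∀ m, ∀ᵐ x ∂(volume.restrict D), |ψ m x| ≤ c m)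
    (hac : Summable fun m => p m * a m * c m) (hZ : IsMixedProcess D T g p φ ψ P Z) {t : ℝ}
    (ht : t ∈ Ioo 0 T) {F : Set (E d)} (hF : MeasurableSet F) :
    P.real (Z t ⁻¹' F) = ∫ q, mixture p φ ψ q * bridge D g t (T - t) F q
      ∂((volume.restrict D).prod (volume.restrict D)) := by
  have hT : 0 < T := ht.1.trans ht.2
  have hTm : T ∈ Ioc 0 T := ⟨hT, le_rfl⟩
  have hm := hZ.measurable_endpoints hT
  have hgi := hG.integrable_kernel_prod hTm
  have hρ := (integrable_mixture_mul_and_hasSum hp0 hφ hψ hφb hψb hac hgi).1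
  -- The signed measures of the mixture add up to one density for the law of the endpoints.
  have hlaw : ∀ A, MeasurableSet A → (P.map fun ω => (Z 0 ω, Z T ω)).real A =
      ∫ q in A, mixture p φ ψ q * g q.1 T q.2
        ∂((volume.restrict D).prod (volume.restrict D)) := by
    intro A hA
    have h1 := hZ.endpoints A hA
    simp_rw [endpointMeasure_eq hA] at h1
    have h2 := (integrable_mixture_mul_and_hasSum hp0 hφ hψ hφb hψb hac (hgi.indicator hA)).2
    rw [map_measureReal_apply hm hA]
    refine (h1.unique h2).trans ?_
    rw [← integral_indicator hA]
    refine integral_congr_ae (.of_forall fun q => ?_)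
    by_cases hq : q ∈ A
    · simp only [indicator_of_mem hq]
    · simp only [indicator_of_notMem hq, mul_zero]
  have hsig : sigmaOf Z {0, T} ≤ ‹MeasurableSpace Ω› := by
    refine iSup₂_le fun τ hτ => ?_
    rcases hτ with rfl | rfl
    · exact (hZ.isBernstein.measurable _ ⟨le_rfl, hT.le⟩).comap_le
    · exact (hZ.isBernstein.measurable _ ⟨hT.le, le_rfl⟩).comap_le
  have hpre : MeasurableSet (Z t ⁻¹' F) :=
    hZ.isBernstein.measurable t ⟨ht.1.le, ht.2.le⟩ hF
  calc P.real (Z t ⁻¹' F) = ∫ ω, (Z t ⁻¹' F).indicator (fun _ => (1 : ℝ)) ω ∂P := by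
        rw [integral_indicator hpre]; simp
    _ = ∫ ω, (P[(Z t ⁻¹' F).indicator (fun _ => (1 : ℝ)) | sigmaOf Z {0, T}]) ω ∂P :=
        (integral_condExp hsig).symm
    _ = ∫ ω, transition D g (Z T ω) T F t (Z 0 ω) 0 ∂P :=
        integral_congr_ae (hZ.transition_eq 0 t T le_rfl ht.1 ht.2 le_rfl F hF)
    _ = ∫ q, transition D g q.2 T F t q.1 0 ∂(P.map fun ω => (Z 0 ω, Z T ω)) :=
        (integral_map hm.aemeasurable
          (measurable_transition hG ht F).aestronglyMeasurable).symm
    _ = ∫ q, mixture p φ ψ q * g q.1 T q.2 * transition D g q.2 T F t q.1 0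
          ∂((volume.restrict D).prod (volume.restrict D)) := by
        have := Measure.isProbabilityMeasure_map (μ := P) hm.aemeasurable
        exact integral_eq_of_measureReal_eq hρ hlaw _
    -- The kernel in the endpoint density cancels the denominator of the transition function.
    _ = _ := by
        refine integral_congr_ae ?_
        filter_upwards [hG.kernel_mul_transition ht hF] with q hq
        rw [mul_assoc, hq]

/-- The law of the process at time `t` is the mixture of the signed densities `uₘ(t) vₘ(t)`. -/
theorem hasSum_measureReal_preimage (hT : 0 < T) (hG : IsHeatFlow D T g) (hp0 : ∀ m, 0 ≤ p m)
    (hφ : ∀ m, MemLp (φ m) 2 (volume.restrict D)) (hψ : ∀ m, MemLp (ψ m) 2 (volume.restrict D))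
    (hφb : ∀ m, ∀ᵐ x ∂(volume.restrict D), |φ m x| ≤ a m)
    (hψb : ∀ m, ∀ᵐ x ∂(volume.restrict D), |ψ m x| ≤ c m)
    (hac : Summable fun m => p m * a m * c m) (hZ : IsMixedProcess D T g p φ ψ P Z) {t : ℝ}
    (ht : t ∈ Icc 0 T) {F : Set (E d)} (hF : MeasurableSet F) :
    HasSum (fun m => p m * ∫ x in F, heatAct D g t (φ m) x * heatAct D g (T - t) (ψ m) x
      ∂(volume.restrict D)) (P.real (Z t ⁻¹' F)) := by
  have hTm : T ∈ Ioc 0 T := ⟨hT, le_rfl⟩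
  -- The transition function describes only interior times. At t = 0 and t = T the law of Z_t is a
  -- marginal of the endpoint law, and one of the two heat flows is the identity.
  rcases ht.1.eq_or_lt with rfl | h0
  · have hset : Z 0 ⁻¹' F = {ω | (Z 0 ω, Z T ω) ∈ F ×ˢ (univ : Set (E d))} := by
      ext ω
      simp
    rw [hset]
    refine HasSum.congr_fun (hZ.endpoints _ (hF.prod .univ)) fun m => ?_
    congr 1
    rw [endpointMeasure_eq (hF.prod .univ), ← integral_indicator hF, sub_zero]
    have := hG.integral_mul_kernel_mul hTm ((hφ m).indicator hF) (hψ m)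
    rw [heatAct_zero]
    refine Eq.trans ?_ (this.symm.trans ?_)
    · refine integral_congr_ae (.of_forall fun x => ?_)
      by_cases hx : x ∈ F
      · simp only [indicator_of_mem hx]
      · simp only [indicator_of_notMem hx, zero_mul]
    · refine integral_congr_ae (.of_forall fun q => ?_)
      by_cases hx : q.1 ∈ F
      · have hq : q ∈ F ×ˢ (univ : Set (E d)) := ⟨hx, mem_univ _⟩
        simp only [indicator_of_mem hx, indicator_of_mem hq]
        ring
      · have hq : q ∉ F ×ˢ (univ : Set (E d)) := fun h => hx h.1
        simp only [indicator_of_notMem hx, indicator_of_notMem hq, zero_mul, mul_zero]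
  rcases ht.2.eq_or_lt with rfl | h1
  · have hset : Z t ⁻¹' F = {ω | (Z 0 ω, Z t ω) ∈ (univ : Set (E d)) ×ˢ F} := by
      ext ω
      simp
    rw [hset]
    refine HasSum.congr_fun (hZ.endpoints _ (MeasurableSet.univ.prod hF)) fun m => ?_
    congr 1
    rw [endpointMeasure_eq (MeasurableSet.univ.prod hF), ← integral_indicator hF, sub_self]
    have := hG.integral_mul_kernel_mul hTm (hφ m) ((hψ m).indicator hF)
    rw [heatAct_zero]
    rw [← hG.integral_mul_symm (hφ m) ((hψ m).indicator hF) (Ioc_subset_Icc_self hTm)] at this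
    refine Eq.trans ?_ (this.symm.trans ?_)
    · refine integral_congr_ae (.of_forall fun x => ?_)
      by_cases hx : x ∈ F
      · simp only [indicator_of_mem hx]
      · simp only [indicator_of_notMem hx, mul_zero]
    · refine integral_congr_ae (.of_forall fun q => ?_)
      by_cases hx : q.2 ∈ F
      · have hq : q ∈ (univ : Set (E d)) ×ˢ F := ⟨mem_univ _, hx⟩
        simp only [indicator_of_mem hx, indicator_of_mem hq]
        ring
      · have hq : q ∉ (univ : Set (E d)) ×ˢ F := fun h => hx h.2
        simp only [indicator_of_notMem hx, indicator_of_notMem hq, mul_zero]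
  · have hs1 : t ∈ Ioc 0 T := ⟨h0, ht.2⟩
    have hs2 : T - t ∈ Ioc 0 T := ⟨by linarith, by linarith⟩
    rw [hZ.measureReal_preimage hG hp0 (fun m => (hφ m).1) (fun m => (hψ m).1) hφb hψb hac
      ⟨h0, h1⟩ hF]
    convert (integrable_mixture_mul_and_hasSum hp0 (fun m => (hφ m).1) (fun m => (hψ m).1) hφb hψb
      hac (hG.integrable_bridge hs1 hs2 hF)).2 using 3 with m
    exact (hG.integrable_mul_bridge_and_integral hs1 hs2 (hφ m) (hψ m) hF).2.symm

/-- The expectation of a bounded observable. -/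
theorem integrable_and_hasSum_integral (hT : 0 < T) (hG : IsHeatFlow D T g)
    (hp0 : ∀ m, 0 ≤ p m)
    (hφ : ∀ m, MemLp (φ m) 2 (volume.restrict D)) (hψ : ∀ m, MemLp (ψ m) 2 (volume.restrict D))
    (hφb : ∀ m, ∀ᵐ x ∂(volume.restrict D), |φ m x| ≤ a m)
    (hψb : ∀ m, ∀ᵐ x ∂(volume.restrict D), |ψ m x| ≤ c m)
    (hac : Summable fun m => p m * a m * c m) (hZ : IsMixedProcess D T g p φ ψ P Z) {t : ℝ}
    (ht : t ∈ Icc 0 T)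
    (huv : Summable fun m => p m *
      ∫ x in D, |heatAct D g t (φ m) x * heatAct D g (T - t) (ψ m) x|)
    {b : E d → ℝ} (hb : MemLp b ∞ (volume.restrict D)) :
    Integrable (fun ω => b (Z t ω)) P ∧
      HasSum (fun m => p m * ∫ x in D, b x *
        (heatAct D g t (φ m) x * heatAct D g (T - t) (ψ m) x)) (∫ ω, b (Z t ω) ∂P) := by
  have ht' : T - t ∈ Icc 0 T := ⟨by linarith [ht.2], by linarith [ht.1]⟩
  have hZm := hZ.isBernstein.measurable t ht
  have := Measure.isProbabilityMeasure_map (μ := P) hZm.aemeasurable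
  let F : (Fin d → ℕ) → E d → ℝ := fun m x =>
    p m * (heatAct D g t (φ m) x * heatAct D g (T - t) (ψ m) x)
  have hFi : ∀ m, Integrable (F m) (volume.restrict D) := fun m =>
    ((hG.memLp _ (hφ m) t ht).integrable_mul (hG.memLp _ (hψ m) _ ht')).const_mul (p m)
  have hFs : Summable fun m => ∫ x in D, ‖F m x‖ := by
    convert huv using 2 with m
    rw [← integral_const_mul]
    refine integral_congr_ae (.of_forall fun x => ?_)
    simp only [F]
    rw [norm_mul, Real.norm_eq_abs, Real.norm_eq_abs, abs_of_nonneg (hp0 m)]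
  have hρ := integrable_tsum_of_summable_integral_norm hFi hFs
  have hlaw : ∀ A, MeasurableSet A → (P.map (Z t)).real A =
      ∫ x in A, ∑' m, F m x ∂(volume.restrict D) := by
    intro A hA
    rw [map_measureReal_apply hZm hA]
    refine (hZ.hasSum_measureReal_preimage hT hG hp0 hφ hψ hφb hψb hac ht hA).unique ?_
    have hFsA : Summable fun m => ∫ x in A, ‖F m x‖ ∂(volume.restrict D) :=
      Summable.of_nonneg_of_le (fun m => integral_nonneg fun _ => norm_nonneg _)
        (fun m => setIntegral_le_integral (hFi m).norm (.of_forall fun _ => norm_nonneg _)) hFs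
    refine HasSum.congr_fun
      (hasSum_integral_of_summable_integral_norm (fun m => (hFi m).restrict (s := A)) hFsA) fun m => ?_
    rw [← integral_const_mul]
  obtain ⟨C, hC⟩ : ∃ C : ℝ, ∀ᵐ x ∂(volume.restrict D), |b x| ≤ C :=
    ⟨_, ae_le_lpNorm_exponent_top hb⟩
  -- The function b is measurable and bounded only up to Lebesgue null sets of D; absolute
  -- continuity transfers both properties to the law of Z_t, which in particular does not charge the
  -- complement of D.
  have hac' : P.map (Z t) ≪ volume.restrict D := by
    rw [(eq_withDensity_of_measureReal_eq hρ hlaw).2]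
    exact withDensity_absolutelyContinuous _ _
  have hbm : AEStronglyMeasurable b (P.map (Z t)) := hb.1.mono_ac hac'
  refine ⟨(Integrable.of_bound hbm C (hac'.ae_le hC)).comp_aemeasurable hZm.aemeasurable, ?_⟩
  rw [← integral_map hZm.aemeasurable hbm, integral_eq_of_measureReal_eq hρ hlaw]
  have hbF : ∀ m, Integrable (fun x => F m x * b x) (volume.restrict D) := fun m =>
    (hFi m).mul_bdd hb.1 hC
  have hbFs : Summable fun m => ∫ x in D, ‖F m x * b x‖ := by
    refine Summable.of_nonneg_of_le (fun m => integral_nonneg fun _ => norm_nonneg _) (fun m => ?_)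
      (hFs.mul_right C)
    rw [← integral_mul_const]
    refine integral_mono_ae (hbF m).norm ((hFi m).norm.mul_const C) ?_
    filter_upwards [hC] with x hx
    rw [norm_mul]
    exact mul_le_mul_of_nonneg_left hx (norm_nonneg _)
  have hsum := hasSum_integral_of_summable_integral_norm hbF hbFs
  simp_rw [tsum_mul_right] at hsum
  refine HasSum.congr_fun hsum fun m => ?_
  rw [← integral_const_mul]
  refine integral_congr_ae (.of_forall fun x => ?_)
  simp only [F]
  ring

end IsMixedProcess

end Mixture

end Bernstein

namespace Bernstein

/-! ### Norm bounds in L² and assembly of the theorem. -/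

variable {d : ℕ} {D : Set (E d)}

theorem norm_toL2_le [IsFiniteMeasure (volume.restrict D)] {f : E d → ℝ}
    (hf : MemLp f 2 (volume.restrict D)) {C : ℝ} (hC : 0 ≤ C)
    (hfC : ∀ᵐ x ∂(volume.restrict D), |f x| ≤ C) :
    ‖toL2 hf‖ ≤ measureUnivNNReal (volume.restrict D) ^ (2 : ℝ≥0∞).toReal⁻¹ * C := by
  refine Lp.norm_le_of_ae_bound hC ?_
  filter_upwards [coeFn_toL2 hf, hfC] with x h1 h2
  rwa [h1, Complex.norm_real]

theorem integral_abs_mul_le_norm_mul_norm {u v : L2 D} {f h : E d → ℝ}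
    (hf : MemLp f 2 (volume.restrict D)) (hh : MemLp h 2 (volume.restrict D))
    (hu : u =ᵐ[volume.restrict D] fun x => (f x : ℂ))
    (hv : v =ᵐ[volume.restrict D] fun x => (h x : ℂ)) :
    ∫ x in D, |f x * h x| ≤ ‖u‖ * ‖v‖ := by
  have key : ∀ {w : L2 D} {k : E d → ℝ} (hk : MemLp k 2 (volume.restrict D)),
      (w =ᵐ[volume.restrict D] fun x => (k x : ℂ)) → ‖toL2 hk.abs‖ ≤ ‖w‖ := by
    intro w k hk hw
    refine Lp.norm_le_norm_of_ae_le ?_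
    filter_upwards [coeFn_toL2 hk.abs, hw] with x h1 h2
    rw [h1, h2, Complex.norm_real, Complex.norm_real]
    simp
  have h1 := inner_of_ae_eq (coeFn_toL2 hf.abs) (coeFn_toL2 hh.abs)
  have h2 := norm_inner_le_norm (𝕜 := ℂ) (toL2 hf.abs) (toL2 hh.abs)
  rw [h1, Complex.norm_real] at h2
  simp only [Pi.abs_apply, ← abs_mul] at h2
  exact (le_abs_self _).trans (h2.trans (mul_le_mul (key hf hu) (key hh hv) (norm_nonneg _)
    (norm_nonneg _)))

end Bernstein

theorem propositionA1
    {d : ℕ} (hd : 1 ≤ d)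
    (D : Set (Bernstein.E d)) (hDo : IsOpen D) (hDc : IsConnected D)
    (hDb : Bornology.IsBounded D)
    (V : Bernstein.E d → ℝ) (q : ℝ≥0∞)
    (hq1 : d = 1 → 1 ≤ q) (hq2 : d = 2 → 1 < q) (hq3 : 3 ≤ d → (d : ℝ≥0∞) / 2 ≤ q)
    (hVq : MemLp V q (volume.restrict D))
    (hVb : ∃ c : ℝ, ∀ᵐ x ∂(volume.restrict D), c ≤ V x)
    (T : ℝ) (hT : 0 < T)
    (g : Bernstein.E d → ℝ → Bernstein.E d → ℝ) (hg : Bernstein.IsHeatKernel D V T g)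
    (p : (Fin d → ℕ) → ℝ) (hp0 : ∀ m, 0 ≤ p m) (hp1 : HasSum p 1)
    (φ ψ : (Fin d → ℕ) → Bernstein.E d → ℝ)
    (hφc : ∀ m, ContinuousOn (φ m) (closure D)) (hψc : ∀ m, ContinuousOn (ψ m) (closure D))
    -- data bounds, implied by bounds uniform in `m`
    (a c : (Fin d → ℕ) → ℝ)
    (hφb : ∀ m, ∀ x ∈ closure D, |φ m x| ≤ a m) (hψb : ∀ m, ∀ x ∈ closure D, |ψ m x| ≤ c m)
    (hac : Summable fun m => p m * a m * c m)
    -- biorthonormality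
    (hbi : ∀ m n, ∫ x in D, φ m x * Bernstein.heatAct D g T (ψ n) x = if m = n then 1 else 0) :
    ∀ t ∈ Icc 0 T, ∃ u v : (Fin d → ℕ) → Bernstein.L2 D,
      (∀ m, u m =ᵐ[volume.restrict D] fun x => (Bernstein.heatAct D g t (φ m) x : ℂ)) ∧
      (∀ m, v m =ᵐ[volume.restrict D] fun x => (Bernstein.heatAct D g (T - t) (ψ m) x : ℂ)) ∧
      ∃ R : Bernstein.L2 D →L[ℂ] Bernstein.L2 D,
        (∀ f, HasSum (fun m => (p m : ℂ) • (inner ℂ (u m) f • v m)) (R f)) ∧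
        -- (a)
        Bernstein.HasTrace R 1 ∧
        (∃ σ : ℝ, HasSum (fun m => p m ^ 2) σ ∧ σ ≤ 1 ∧ Bernstein.HasTrace (R ∘L R) (σ : ℂ)) ∧
        -- (b)
        (∀ m, R (v m) = (p m : ℂ) • v m) ∧
        -- (c); `inner ℂ x y` is linear in `y`
        (∀ B : Bernstein.L2 D →L[ℂ] Bernstein.L2 D, IsSelfAdjoint B →
          ∃ τ : ℂ, Bernstein.HasTrace (R ∘L B) τ ∧
            HasSum (fun m => (p m : ℂ) * inner ℂ (B (u m)) (v m)) τ ∧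
            ((∀ f : Bernstein.L2 D, (∀ᵐ x ∂(volume.restrict D), (f x).im = 0) →
                ∀ᵐ x ∂(volume.restrict D), (B f x).im = 0) →
              HasSum (fun m => (p m : ℂ) * inner ℂ (v m) (B (u m))) τ)) ∧
        (∀ b : Bernstein.E d → ℝ, MemLp b ∞ (volume.restrict D) →
          ∀ B : Bernstein.L2 D →L[ℂ] Bernstein.L2 D,
            (∀ f, B f =ᵐ[volume.restrict D] fun x => (b x : ℂ) * f x) →
            ∀ (Ω : Type*) [MeasurableSpace Ω] (P : Measure Ω) [IsProbabilityMeasure P]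
              (Z : ℝ → Ω → Bernstein.E d), Bernstein.IsMixedProcess D T g p φ ψ P Z →
              Integrable (fun ω => b (Z t ω)) P ∧
              HasSum (fun m => p m * ∫ x in D, b x *
                (Bernstein.heatAct D g t (φ m) x * Bernstein.heatAct D g (T - t) (ψ m) x))
                (∫ ω, b (Z t ω) ∂P) ∧
              Bernstein.HasTrace (R ∘L B) ((∫ ω, b (Z t ω) ∂P : ℝ) : ℂ)) := by
  intro t ht
  have hDf : volume D ≠ ∞ := hDb.measure_lt_top.ne
  have : IsFiniteMeasure (volume.restrict D) := ⟨by simpa using hDf.lt_top⟩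
  obtain ⟨V₀, hV₀⟩ := hVb
  obtain ⟨S, hS⟩ := hg.exists_semigroup hT.le
  have hG := hS.isHeatFlow hg hDo hDf hVq.1 hV₀
  obtain ⟨x₀, hx₀⟩ := hDc.nonempty
  have ha0 : ∀ m, 0 ≤ a m := fun m => (abs_nonneg _).trans (hφb m x₀ (subset_closure hx₀))
  have hc0 : ∀ m, 0 ≤ c m := fun m => (abs_nonneg _).trans (hψb m x₀ (subset_closure hx₀))
  have hφa : ∀ m, ∀ᵐ x ∂(volume.restrict D), |φ m x| ≤ a m := fun m =>
    ae_restrict_of_forall_mem hDo.measurableSet fun x hx => hφb m x (subset_closure hx)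
  have hψa : ∀ m, ∀ᵐ x ∂(volume.restrict D), |ψ m x| ≤ c m := fun m =>
    ae_restrict_of_forall_mem hDo.measurableSet fun x hx => hψb m x (subset_closure hx)
  have hφm : ∀ m, MemLp (φ m) 2 (volume.restrict D) := fun m =>
    MemLp.of_bound (((hφc m).mono subset_closure).aestronglyMeasurable hDo.measurableSet) (a m)
      (hφa m)
  have hψm : ∀ m, MemLp (ψ m) 2 (volume.restrict D) := fun m =>
    MemLp.of_bound (((hψc m).mono subset_closure).aestronglyMeasurable hDo.measurableSet) (c m)
      (hψa m)
  have ht' : T - t ∈ Icc 0 T := ⟨by linarith [ht.2], by linarith [ht.1]⟩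
  let u : (Fin d → ℕ) → Bernstein.L2 D := fun m => S t (Bernstein.toL2 (hφm m))
  let v : (Fin d → ℕ) → Bernstein.L2 D := fun m => S (T - t) (Bernstein.toL2 (hψm m))
  have hu : ∀ m, u m =ᵐ[volume.restrict D] fun x => (Bernstein.heatAct D g t (φ m) x : ℂ) :=
    fun m => hS.apply_toL2 (hφm m) ht
  have hv : ∀ m, v m =ᵐ[volume.restrict D]
      fun x => (Bernstein.heatAct D g (T - t) (ψ m) x : ℂ) := fun m => hS.apply_toL2 (hψm m) ht'
  have huv : Summable fun m => p m * (‖u m‖ * ‖v m‖) := by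
    -- M is |D|^{1/2}, the constant that bounds the L² norm by the sup norm.
    let M : ℝ := measureUnivNNReal (volume.restrict D) ^ (2 : ℝ≥0∞).toReal⁻¹
    refine Summable.of_nonneg_of_le (fun m => mul_nonneg (hp0 m) (by positivity)) (fun m => ?_)
      (hac.mul_left (‖S t‖ * M * (‖S (T - t)‖ * M)))
    have h1 : ‖u m‖ ≤ ‖S t‖ * (M * a m) := ((S t).le_opNorm _).trans
      (mul_le_mul_of_nonneg_left (Bernstein.norm_toL2_le _ (ha0 m) (hφa m)) (norm_nonneg _))
    have h2 : ‖v m‖ ≤ ‖S (T - t)‖ * (M * c m) := ((S (T - t)).le_opNorm _).trans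
      (mul_le_mul_of_nonneg_left (Bernstein.norm_toL2_le _ (hc0 m) (hψa m)) (norm_nonneg _))
    calc p m * (‖u m‖ * ‖v m‖)
        ≤ p m * (‖S t‖ * (M * a m) * (‖S (T - t)‖ * (M * c m))) :=
          mul_le_mul_of_nonneg_left
            (mul_le_mul h1 h2 (norm_nonneg _) ((norm_nonneg _).trans h1)) (hp0 m)
      _ = ‖S t‖ * M * (‖S (T - t)‖ * M) * (p m * a m * c m) := by ring
  -- The flow over t is moved to the other factor, where it completes T - t to T and gives the
  -- assumed biorthonormality.
  have hbio : ∀ m n, (inner ℂ (u m) (v n) : ℂ) = if m = n then 1 else 0 := by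
    intro m n
    have h1 := hS.inner_add (Bernstein.toL2 (hφm m)) (Bernstein.toL2 (hψm n)) t (T - t) ht.1 ht'.1
      (by linarith)
    have hTT : T ∈ Icc 0 T := ⟨hT.le, le_rfl⟩
    rw [add_sub_cancel, hS.inner_symm hTT, Bernstein.inner_of_ae_eq
      (Bernstein.coeFn_toL2 (hφm m)) (hS.apply_toL2 (hψm n) hTT), hbi] at h1
    rw [← h1]
    split_ifs <;> simp
  -- The weight pₘ is attached to vₘ, so that R is nuclear with the vectors uₘ and pₘ vₘ.
  have hnuc : Summable fun m => ‖u m‖ * ‖(p m : ℂ) • v m‖ := by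
    refine huv.congr fun m => ?_
    rw [norm_smul, Complex.norm_real, Real.norm_eq_abs, abs_of_nonneg (hp0 m)]
    ring
  obtain ⟨R, hR⟩ := Bernstein.exists_nuclear hnuc
  have hRv : ∀ m, R (v m) = (p m : ℂ) • v m := by
    intro n
    refine (hR (v n)).unique ?_
    refine (hasSum_ite_eq n ((p n : ℂ) • v n)).congr_fun fun m => ?_
    rw [hbio]
    split_ifs with h
    · rw [h, one_smul]
    · rw [zero_smul]
  have hple : ∀ m, p m ≤ 1 := fun m => le_hasSum hp1 m fun k _ => hp0 k
  have hsq : ∀ m, p m ^ 2 ≤ p m := fun m => by nlinarith [hp0 m, hple m]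
  have hsqs : Summable fun m => p m ^ 2 :=
    Summable.of_nonneg_of_le (fun m => sq_nonneg _) hsq hp1.summable
  refine ⟨u, v, hu, hv, R, fun f => ?_, ?_, ⟨∑' m, p m ^ 2, hsqs.hasSum,
    hasSum_le hsq hsqs.hasSum hp1, ?_⟩, hRv, fun B hB => ?_, fun b hb B hB Ω _ P _ Z hZ => ?_⟩
  · exact (hR f).congr_fun fun m => smul_comm _ _ _
  · refine Bernstein.hasTrace_of_nuclear hnuc hR ?_
    have := hp1.mapL Complex.ofRealCLM
    simpa [inner_smul_right, hbio] using this
  -- R² is treated as R composed with B = R; the eigenvector relation gives ⟨uₘ, R(pₘ vₘ)⟩ = pₘ².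
  · refine Bernstein.hasTrace_nuclear_comp hnuc hR R ?_
    refine (hsqs.hasSum.mapL Complex.ofRealCLM).congr_fun fun m => ?_
    rw [map_smul, hRv, inner_smul_right, inner_smul_right, hbio, if_pos rfl, mul_one,
      Complex.ofRealCLM_apply, Complex.ofReal_pow, sq]
  · have hBs : ∀ x y : Bernstein.L2 D, (inner ℂ x (B y) : ℂ) = inner ℂ (B x) y := fun x y => by
      rw [← ContinuousLinearMap.adjoint_inner_left, ← ContinuousLinearMap.star_eq_adjoint,
        hB.star_eq]
    have hsum := (Bernstein.summable_inner_comp_of_nuclear hnuc B).hasSum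
    have hsum' : HasSum (fun m => (p m : ℂ) * inner ℂ (B (u m)) (v m))
        (∑' m, inner ℂ (u m) (B ((p m : ℂ) • v m))) :=
      hsum.congr_fun fun m => by rw [map_smul, inner_smul_right, hBs]
    refine ⟨_, Bernstein.hasTrace_nuclear_comp hnuc hR B hsum, hsum', fun hreal => ?_⟩
    refine hsum'.congr_fun fun m => ?_
    -- As uₘ is real, so is B uₘ, and the inner product of two real functions is symmetric.
    have hBu : B (u m) =ᵐ[volume.restrict D] fun x => ((B (u m) x).re : ℂ) := by
      have h0 : ∀ᵐ x ∂(volume.restrict D), (u m x).im = 0 := by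
        filter_upwards [hu m] with x hx
        rw [hx, Complex.ofReal_im]
      filter_upwards [hreal (u m) h0] with x hx
      exact Complex.ext (by simp) (by simp [hx])
    rw [Bernstein.inner_of_ae_eq hBu (hv m), Bernstein.inner_of_ae_eq (hv m) hBu]
    simp only [mul_comm]
  · have hum := fun m => hG.memLp _ (hφm m) t ht
    have hvm := fun m => hG.memLp _ (hψm m) _ ht'
    have huv' : Summable fun m => p m * ∫ x in D,
        |Bernstein.heatAct D g t (φ m) x * Bernstein.heatAct D g (T - t) (ψ m) x| := by
      refine Summable.of_nonneg_of_le
        (fun m => mul_nonneg (hp0 m) (integral_nonneg fun _ => abs_nonneg _)) (fun m => ?_) huv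
      exact mul_le_mul_of_nonneg_left
        (Bernstein.integral_abs_mul_le_norm_mul_norm (hum m) (hvm m) (hu m) (hv m)) (hp0 m)
    obtain ⟨h1, h2⟩ := hZ.integrable_and_hasSum_integral hT hG hp0 hφm hψm hφa hψa hac ht huv' hb
    refine ⟨h1, h2, Bernstein.hasTrace_nuclear_comp hnuc hR B ?_⟩
    refine (h2.mapL Complex.ofRealCLM).congr_fun fun m => ?_
    have hBv : B (v m) =ᵐ[volume.restrict D]
        fun x => ((b x * Bernstein.heatAct D g (T - t) (ψ m) x : ℝ) : ℂ) := by
      filter_upwards [hB (v m), hv m] with x h3 h4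
      rw [h3, h4, Complex.ofReal_mul]
    rw [map_smul, inner_smul_right, Bernstein.inner_of_ae_eq (hu m) hBv,
      Complex.ofRealCLM_apply, Complex.ofReal_mul]
    congr 2
    refine integral_congr_ae (.of_forall fun x => ?_)
    ring
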